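/- Fix $n$, $\gamma\in(0,1)$, $T>0$, $\tau>0$, $s>0$, $p>0$ and $\kappa>0$. Write $\widehat f(\xi)=(2\pi)^{-n/2}\int_{\mathbb{R}^n}f(x)e^{-ix\cdot\xi}\,dx$ for the unitary Fourier transform on $L^2(\mathbb{R}^n)$, $\|f\|_{H^l}=\|(1+|\xi|^2)^{l/2}\widehat f\|_{L^2}$, $E_{\gamma,1}(z)=\sum_{k\ge 0} z^k/\Gamma(\gamma k+1)$, and $\widehat\varphi(\xi)=(2\pi)^{-n/2}e^{-\tau|\xi|^s}$. Let $u\in C([0,T],L^2(\mathbb{R}^n))\cap C((0,T],H^2(\mathbb{R}^n))$ be a solution of $\frac{\partial^\gamma u}{\partial t^\gamma}=\Delta u$ on $\mathbb{R}^n\times(0,T)$, $u(\cdot,T)=g$. Here $\frac{\partial^\gamma u}{\partial t^\gamma}(t)=\frac1{\Gamma(1-\gamma)}\int_0^t\frac{u'(r)}{(t-r)^\gamma}\,dr$ is the Caputo derivative ($u$ is differentiable on $(0,T)$ with values in $L^2$ and the integral is absolutely convergent in $L^2$), the equation holds in $L^2(\mathbb{R}^n)$ for every $t\in(0,T)$,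 and $\|u(\cdot,t)-g\|_{H^2}\to0$ as $t\to T$. Assume $u(\cdot,0)\in H^p(\mathbb{R}^n)$ with $\|u(\cdot,0)\|_{H^p}\le E$, $E>0$. Let $g^\delta\in L^2(\mathbb{R}^n)$ satisfy $\|g-g^\delta\|_{L^2}\le\delta$, where $\delta\le\kappa E$. Let $0\le h\le 1/2$ and let $\psi_h$ be a positive function on $[0,\infty)\times(0,T]$ such that, for every $t\in(0,T]$, $$\left\|\frac{\psi_h(|\xi|,t)-E_{\gamma,1}(-|\xi|^2t^\gamma)}{E_{\gamma,1}(-|\xi|^2t^\gamma)}\right\|_{L^\infty(\mathbb{R}^n)}\le h.$$ For $t\in(0,T]$ let $u_\alpha^{\delta,h}(\cdot,t)$ be the regularized solution defined by $$\widehat{u_\alpha^{\delta,h}}(\xi,t)=(2\pi)^{n/2}\,\widehat\varphi(\alpha\xi)\,\frac{\psi_h(|\xi|,t)}{\psi_h(|\xi|,T)}\,\widehat{g^\delta}(\xi).$$ Then, with $\alpha=(h+\delta/E)^{1/(p+2)}$, for all $t\in(0,T]$ and all $l\in[0,p+2]$ with $p+2-l\le s$, $$\|u(\cdot,t)-u^{\delta,h}_{\alpha}(\cdot,t)\|_{H^l}\le\frac{C}{t^\gamma}\,E^{\frac{l}{p+2}}(\delta+hE)^{1-\frac{l}{p+2}},$$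 where $C>0$ depends only on $n,\gamma,T,\tau,s,p,\kappa$; in particular it does not depend on $\delta,h,E,t,l,u,g,g^\delta,\psi_h$. -/

import Mathlib

noncomputable section

open MeasureTheory Filter Topology Set
open scoped ENNReal FourierTransform SchwartzMap Laplacian

namespace FracDiffusion

/-- Euclidean space `ℝⁿ`. -/
abbrev V (n : ℕ) : Type := EuclideanSpace ℝ (Fin n)

/-- The (complex) Hilbert space `L²(ℝⁿ)`. -/
abbrev L2 (n : ℕ) : Type := Lp (α := V n) ℂ 2 volume

/-- The unitary Fourier transform on `L²(ℝⁿ)` in angular frequency,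
`f̂(ξ) = (2π)^{-n/2} ∫ f(x) e^{-i x·ξ} dx`, extended from Schwartz functions to `L²` by continuity.
Mathlib's transform `𝓕` uses `e^{-2πi x·η}`, hence `f̂(ξ) = (2π)^{-n/2} (𝓕 f)(ξ / 2π)`. -/
def hat {n : ℕ} (f : L2 n) (ξ : V n) : ℂ :=
  (((2 * Real.pi) ^ (-(n : ℝ) / 2) : ℝ) : ℂ) * (𝓕 f : L2 n) ((2 * Real.pi)⁻¹ • ξ)

/-- The inverse of `hat`: the element of `L²(ℝⁿ)` whose Fourier transform is the square-integrable
function `F` (and `0` if `F` is not square-integrable). -/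
def invHat {n : ℕ} (F : V n → ℂ) : L2 n := by
  classical
  exact
    if hF : MemLp (fun η : V n ↦
        (((2 * Real.pi) ^ ((n : ℝ) / 2) : ℝ) : ℂ) * F ((2 * Real.pi) • η)) 2 volume
    then 𝓕⁻ (hF.toLp _ : L2 n)
    else 0

/-- The Sobolev norm `‖f‖_{H^l} = ‖(1 + |ξ|²)^{l/2} f̂(ξ)‖_{L²}` of `f ∈ L²(ℝⁿ)`, for `l ≥ 0`,
as an extended nonnegative real: it is finite exactly when `f ∈ H^l(ℝⁿ)`. -/
def sobolevNorm {n : ℕ} (l : ℝ) (f : L2 n) : ℝ≥0∞ :=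
  eLpNorm (fun ξ : V n ↦ (((1 + ‖ξ‖ ^ 2) ^ (l / 2) : ℝ) : ℂ) * hat f ξ) 2 volume

/-- The Mittag-Leffler function `E_{γ,1}` on the real line. -/
def mittagLeffler (γ x : ℝ) : ℝ := ∑' k : ℕ, x ^ k / Real.Gamma (γ * k + 1)

/-- The Caputo derivative `(1/Γ(1-γ)) ∫₀ᵗ u'(s) (t-s)^{-γ} ds` of an `L²(ℝⁿ)`-valued function. -/
def caputo {n : ℕ} (γ : ℝ) (u : ℝ → L2 n) (t : ℝ) : L2 n :=
  (Real.Gamma (1 - γ))⁻¹ • ∫ s in (0 : ℝ)..t, (t - s) ^ (-γ) • deriv u s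

/-- `u ∈ C([0,T], L²) ∩ C((0,T], H²)` solves `∂^γ u / ∂t^γ = Δ u` in `L²(ℝⁿ)` for `t ∈ (0,T)`,
with final value `u(·,T) = g`. The Laplacian is that of tempered distributions. -/
structure IsSolution {n : ℕ} (γ T : ℝ) (u : ℝ → L2 n) (g : L2 n) : Prop where
  continuousOn : ContinuousOn u (Icc 0 T)
  mem_H2 : ∀ t ∈ Ioc 0 T, sobolevNorm 2 (u t) < ⊤
  continuousOn_H2 : ∀ t₀ ∈ Ioc 0 T,
    Tendsto (fun t ↦ sobolevNorm 2 (u t - u t₀)) (𝓝[Ioc 0 T] t₀) (𝓝 0)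
  differentiableAt : ∀ t ∈ Ioo 0 T, DifferentiableAt ℝ u t
  integrable : ∀ t ∈ Ioo 0 T,
    IntervalIntegrable (fun s ↦ (t - s) ^ (-γ) • deriv u s) volume 0 t
  equation : ∀ t ∈ Ioo 0 T, ((caputo γ u t : L2 n) : 𝓢'(V n, ℂ)) = Δ ((u t : L2 n) : 𝓢'(V n, ℂ))
  final : Tendsto (fun t ↦ sobolevNorm 2 (u t - g)) (𝓝[<] T) (𝓝 0)

/-- The Fourier transform `φ̂(ξ) = (2π)^{-n/2} exp(-τ|ξ|^s)` of the mollifier kernel `φ`. -/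
def kernelHat (n : ℕ) (τ s : ℝ) (ξ : V n) : ℝ :=
  (2 * Real.pi) ^ (-(n : ℝ) / 2) * Real.exp (-τ * ‖ξ‖ ^ s)

/-- `ψ` is a positive function on `[0,∞) × (0,T]` (measurable in the first variable) that
approximates `(r,t) ↦ E_{γ,1}(-r² t^γ)` with relative error at most `h`, in `L^∞(ℝⁿ)` for `r = |ξ|`
and for every `t ∈ (0,T]`. -/
structure IsApproxSymbol (n : ℕ) (γ T h : ℝ) (ψ : ℝ → ℝ → ℝ) : Prop where
  pos : ∀ r, 0 ≤ r → ∀ t ∈ Ioc 0 T, 0 < ψ r t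
  aestronglyMeasurable : ∀ t ∈ Ioc 0 T,
    AEStronglyMeasurable (fun ξ : V n ↦ ψ ‖ξ‖ t) volume
  bound : ∀ t ∈ Ioc 0 T,
    eLpNorm (fun ξ : V n ↦ (ψ ‖ξ‖ t - mittagLeffler γ (-(‖ξ‖ ^ 2) * t ^ γ)) /
      mittagLeffler γ (-(‖ξ‖ ^ 2) * t ^ γ)) ⊤ volume ≤ ENNReal.ofReal h

/-- The regularized solution `u_α^{δ,h}(·,t)`, `t ∈ (0,T]`, from the data `gδ` and the approximate
symbol `ψ`: its Fourier transform is
`(2π)^{n/2} φ̂(αξ) (ψ(|ξ|,t) / ψ(|ξ|,T)) ĝ^δ(ξ)`. -/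
def regularized {n : ℕ} (τ s T : ℝ) (ψ : ℝ → ℝ → ℝ) (gδ : L2 n) (α t : ℝ) : L2 n :=
  invHat fun ξ : V n ↦
    (((2 * Real.pi) ^ ((n : ℝ) / 2) * kernelHat n τ s (α • ξ) * (ψ ‖ξ‖ t / ψ ‖ξ‖ T) : ℝ) : ℂ)
      * hat gδ ξ

theorem ae_comp_smul {n : ℕ} {c : ℝ} (hc : c ≠ 0) {β : Type*} {f g : V n → β}
    (h : f =ᵐ[volume] g) : (fun ξ ↦ f (c • ξ)) =ᵐ[volume] fun ξ ↦ g (c • ξ) := by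
  have hq : Measure.QuasiMeasurePreserving (fun ξ : V n ↦ c • ξ) volume volume := by
    refine ⟨measurable_const_smul c, ?_⟩
    rw [Measure.map_addHaar_smul volume hc]
    exact Measure.smul_absolutelyContinuous
  exact hq.ae_eq_comp h

/-- `hat` is the usual integral on Schwartz functions. -/
theorem hat_schwartz {n : ℕ} (f : 𝓢(V n, ℂ)) :
    hat (f.toLp 2 volume) =ᵐ[volume] fun ξ : V n ↦
      (((2 * Real.pi) ^ (-(n : ℝ) / 2) : ℝ) : ℂ) *
        ∫ x : V n, Complex.exp (-Complex.I * (inner ℝ x ξ : ℝ)) * f x := by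
  have hpi : (2 * Real.pi)⁻¹ ≠ 0 := by positivity
  have h := ae_comp_smul hpi ((𝓕 f).coeFn_toLp 2 (volume : Measure (V n)))
  unfold hat
  rw [SchwartzMap.toLp_fourier_eq]
  filter_upwards [h] with ξ hξ
  rw [hξ, SchwartzMap.fourier_coe, Real.fourier_eq]
  congr 1
  refine integral_congr_ae (Eventually.of_forall fun x ↦ ?_)
  simp only [Circle.smul_def, Real.fourierChar_apply, smul_eq_mul, inner_smul_right]
  congr 2
  push_cast
  have : (Real.pi : ℂ) ≠ 0 := by exact_mod_cast Real.pi_ne_zero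
  field_simp

/-- `invHat` inverts `hat` on square-integrable functions. -/
theorem hat_invHat {n : ℕ} {F : V n → ℂ} (hF : MemLp F 2 volume) :
    hat (invHat F) =ᵐ[volume] F := by
  have h2 : (2 * Real.pi) ≠ 0 := by positivity
  have hpi : (2 * Real.pi)⁻¹ ≠ 0 := inv_ne_zero h2
  have hG : MemLp (fun η : V n ↦
      (((2 * Real.pi) ^ ((n : ℝ) / 2) : ℝ) : ℂ) * F ((2 * Real.pi) • η)) 2 volume := by
    refine MemLp.const_mul ?_ _
    have hm : MemLp F 2 (Measure.map (fun η : V n ↦ (2 * Real.pi) • η) volume) := by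
      rw [Measure.map_addHaar_smul volume h2]
      exact hF.smul_measure ENNReal.ofReal_ne_top
    exact hm.comp_of_map (measurable_const_smul _).aemeasurable
  have h := ae_comp_smul hpi hG.coeFn_toLp
  unfold hat invHat
  rw [dif_pos hG, FourierTransform.fourier_fourierInv_eq]
  filter_upwards [h] with ξ hξ
  rw [hξ, smul_smul, mul_inv_cancel₀ h2, one_smul, ← mul_assoc, ← Complex.ofReal_mul,
    ← Real.rpow_add (by positivity)]
  simp [neg_div]

end FracDiffusion

end

open FracDiffusion

open MeasureTheory Filter Topology Set
open scoped ENNReal FourierTransform SchwartzMap Laplacian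

namespace FracDiffusion

/-! ### The Riemann-Liouville fractional integral -/

/-! On the Fourier side the solution is `û(ξ,t) = e_t(ξ) û(ξ,0)` with `e_t(ξ) = E_{γ,1}(-|ξ|² t^γ)`
(`hat_solution`). To prove this for an `L²`-valued solution, integrate `𝓕 u` against powers of the
symbol of `-Δ` over a bounded set. These moments satisfy `v_k = v_k(0) - I^γ v_{k+1}`, where `I^γ`
is the Riemann-Liouville integral, and iterating produces the Mittag-Leffler series with a remainder
tending to zero (`hasSum_of_volterra`).

The analytic input is that `E_{γ,1}(-x)` is comparable to `1 / (1 + x)` for `x ≥ 0`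
(`mittagLeffler_neg_bounds`). It rests on the positivity of `t^{γ-1} E_{γ,γ}(-t^γ)`
(`mlFun_self_pos`), obtained by a real-variable argument on a Volterra equation. Consequently `e_t`
is at most a multiple of `t^{-γ} / (1 + |ξ|²)`, and `e_t / e_T` at most a multiple of `t^{-γ}`.

With `K = exp(-τ|αξ|^s)` and `r = ψ(|ξ|,t) / ψ(|ξ|,T)`, the error splits into a bias `e_t (1 - K)
û(ξ,0)`, a symbol error `K (e_t - r e_T) û(ξ,0)` and a noise term `K r` times the data error. In
`H^l` they are at most multiples of `t^{-γ}` times `α^{p+2-l} E`, `h E` and `α^{-l} δ` respectively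
(`one_sub_exp_le`, `approx_ratio_bounds`, `exists_rpow_mul_exp_le`). The choice `α^{p+2} = h + δ/E`
bounds all three by a multiple of `t^{-γ} α^{p+2-l} E`, which is the claimed rate. -/

theorem integral_sub_rpow_mul_rpow {a b t : ℝ} (ha : 0 < a) (hb : 0 < b) (ht : 0 < t) :
    ∫ s in (0 : ℝ)..t, (t - s) ^ (a - 1) * s ^ (b - 1) =
      Real.Gamma a * Real.Gamma b / Real.Gamma (a + b) * t ^ (a + b - 1) := by
  have h := Complex.betaIntegral_scaled (b : ℂ) (a : ℂ) ht
  rw [Complex.betaIntegral_eq_Gamma_mul_div _ _ (by simpa using hb) (by simpa using ha)] at h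
  have h2 : ∫ x in (0 : ℝ)..t, (x : ℂ) ^ ((b : ℂ) - 1) * ((t : ℂ) - x) ^ ((a : ℂ) - 1) =
      ∫ x in (0 : ℝ)..t, (((t - x) ^ (a - 1) * x ^ (b - 1) : ℝ) : ℂ) := by
    refine intervalIntegral.integral_congr fun x hx ↦ ?_
    rw [uIcc_of_le ht.le] at hx
    simp only [Complex.ofReal_mul, Complex.ofReal_cpow hx.1,
      Complex.ofReal_cpow (sub_nonneg.2 hx.2)]
    push_cast
    ring
  rw [h2, intervalIntegral.integral_ofReal, ← Complex.ofReal_add, Complex.Gamma_ofReal,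
    Complex.Gamma_ofReal, Complex.Gamma_ofReal] at h
  have h3 : ((t : ℂ) ^ (((b + a : ℝ) : ℂ) - 1)) = ((t ^ (b + a - 1) : ℝ) : ℂ) := by
    rw [Complex.ofReal_cpow ht.le]; push_cast; rfl
  rw [h3] at h
  have h4 := congrArg Complex.re h
  norm_cast at h4
  rw [h4, add_comm b a]
  ring

/-- The integral of a non-integrable function is zero by convention, so the nonzero beta value
already forces integrability. -/
theorem intervalIntegrable_sub_rpow_mul_rpow {a b t : ℝ} (ha : 0 < a) (hb : 0 < b) (ht : 0 < t) :
    IntervalIntegrable (fun s : ℝ ↦ (t - s) ^ (a - 1) * s ^ (b - 1)) volume 0 t := by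
  refine intervalIntegral.intervalIntegrable_of_integral_ne_zero ?_
  rw [integral_sub_rpow_mul_rpow ha hb ht]
  have := Real.Gamma_pos_of_pos ha
  have := Real.Gamma_pos_of_pos hb
  have := Real.Gamma_pos_of_pos (add_pos ha hb)
  positivity

theorem integral_sub_rpow {a t c : ℝ} (ha : 0 < a) :
    ∫ s in c..t, (t - s) ^ (a - 1) = (t - c) ^ a / a := by
  rw [intervalIntegral.integral_comp_sub_left (fun x : ℝ ↦ x ^ (a - 1)) t,
    integral_rpow (Or.inl (by linarith))]
  simp [Real.zero_rpow ha.ne']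

theorem intervalIntegrable_sub_rpow {a t c d : ℝ} (ha : 0 < a) :
    IntervalIntegrable (fun s : ℝ ↦ (t - s) ^ (a - 1)) volume c d := by
  have := (intervalIntegral.intervalIntegrable_rpow' (a := t - c) (b := t - d)
    (r := a - 1) (by linarith)).comp_sub_left t
  simpa using this

/-- The Riemann-Liouville integral of order `a`, with base point `0`. -/
noncomputable def fracInt {F : Type*} [NormedAddCommGroup F] [NormedSpace ℝ F] (a : ℝ) (f : ℝ → F)
    (t : ℝ) : F :=
  (Real.Gamma a)⁻¹ • ∫ s in (0 : ℝ)..t, (t - s) ^ (a - 1) • f s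

theorem fracInt_rpow {a b t : ℝ} (ha : 0 < a) (hb : 0 < b) (ht : 0 < t) :
    fracInt a (fun s ↦ s ^ (b - 1) / Real.Gamma b) t = t ^ (a + b - 1) / Real.Gamma (a + b) := by
  have h1 := (Real.Gamma_pos_of_pos ha).ne'
  have h2 := (Real.Gamma_pos_of_pos hb).ne'
  have h3 := (Real.Gamma_pos_of_pos (add_pos ha hb)).ne'
  unfold fracInt
  simp only [smul_eq_mul, ← mul_div_assoc]
  rw [intervalIntegral.integral_div, integral_sub_rpow_mul_rpow ha hb ht]
  field_simp

/-! ### Mittag-Leffler series -/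

/-- Keep only the tail `x > M` of Euler's integral, where `x^(y-1) ≥ M^(y-1)`. As `M` is free, `Γ`
outgrows every geometric sequence. -/
theorem rpow_mul_exp_neg_le_Gamma {M y : ℝ} (hM : 0 < M) (hy : 1 ≤ y) :
    M ^ (y - 1) * Real.exp (-M) ≤ Real.Gamma y := by
  rw [Real.Gamma_eq_integral (by linarith), ← integral_exp_neg_Ioi M, ← integral_const_mul]
  have hi := Real.GammaIntegral_convergent (s := y) (by linarith)
  calc ∫ x in Ioi M, M ^ (y - 1) * Real.exp (-x)
      ≤ ∫ x in Ioi M, Real.exp (-x) * x ^ (y - 1) := by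
        refine setIntegral_mono_on ((integrableOn_exp_neg_Ioi M).const_mul _)
          (hi.mono_set (Ioi_subset_Ioi hM.le)) measurableSet_Ioi fun x hx ↦ ?_
        rw [mul_comm]
        have : M ≤ x := (mem_Ioi.1 hx).le
        gcongr
    _ ≤ _ := by
        refine setIntegral_mono_set hi ?_ (Ioi_subset_Ioi hM.le).eventuallyLE
        filter_upwards [self_mem_ae_restrict measurableSet_Ioi] with x hx
        have : 0 < x := hx
        positivity

theorem summable_pow_div_Gamma {γ b : ℝ} (hγ : 0 < γ) (hb : 0 < b) (x : ℝ) :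
    Summable fun k : ℕ ↦ x ^ k / Real.Gamma (γ * k + b) := by
  -- Chosen so that `M^γ = 2|x| + 1`; the terms are then dominated by a multiple of `2^{-k}`.
  set M : ℝ := (2 * |x| + 1) ^ γ⁻¹ with hM
  have hM0 : 0 < M := by positivity
  have hMγ : M ^ γ = 2 * |x| + 1 := Real.rpow_inv_rpow (by positivity) hγ.ne'
  have hsum : Summable fun k : ℕ ↦ (Real.exp M * M ^ (1 - b)) * (1 / 2 : ℝ) ^ k :=
    (summable_geometric_of_lt_one (by norm_num) (by norm_num)).mul_left _
  refine Summable.of_norm_bounded_eventually_nat hsum ?_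
  obtain ⟨N, hN⟩ := exists_nat_ge (1 / γ)
  filter_upwards [eventually_ge_atTop N] with k hk
  have hk' : 1 ≤ γ * k + b := by
    have : 1 / γ ≤ k := hN.trans (by exact_mod_cast hk)
    rw [div_le_iff₀ hγ] at this
    linarith
  have hG := rpow_mul_exp_neg_le_Gamma hM0 hk'
  have hG0 := Real.Gamma_pos_of_pos (by linarith : 0 < γ * k + b)
  rw [norm_div, norm_pow, Real.norm_eq_abs, Real.norm_of_nonneg hG0.le, div_le_iff₀ hG0]
  have h1 : M ^ (γ * k + b - 1) = (2 * |x| + 1) ^ k * M ^ (b - 1) := by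
    rw [add_sub_assoc, Real.rpow_add hM0, Real.rpow_mul hM0.le, hMγ, Real.rpow_natCast]
  have h2 : M ^ (1 - b) * M ^ (b - 1) = 1 := by rw [← Real.rpow_add hM0]; simp
  have h3 : Real.exp M * Real.exp (-M) = 1 := by rw [← Real.exp_add]; simp
  calc |x| ^ k ≤ (1 / 2 * (2 * |x| + 1)) ^ k := by gcongr; linarith
    _ = Real.exp M * M ^ (1 - b) * (1 / 2) ^ k * (M ^ (γ * k + b - 1) * Real.exp (-M)) := by
        rw [h1, mul_pow]
        linear_combination (-(1 / 2 : ℝ) ^ k * (2 * |x| + 1) ^ k) * (h2 + (M ^ (1 - b) * M ^ (b - 1)) * h3)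
    _ ≤ _ := by gcongr

/-- The two-parameter Mittag-Leffler function `E_{γ,b}`. -/
noncomputable def mittagLeffler₂ (γ b x : ℝ) : ℝ := ∑' k : ℕ, x ^ k / Real.Gamma (γ * k + b)

theorem continuous_mittagLeffler₂ {γ b : ℝ} (hγ : 0 < γ) (hb : 0 < b) :
    Continuous (mittagLeffler₂ γ b) := by
  refine continuous_iff_continuousAt.2 fun x₀ ↦ ?_
  have hc : ContinuousOn (mittagLeffler₂ γ b) (Metric.closedBall 0 (|x₀| + 1)) := by
    refine continuousOn_tsum (fun k ↦ by fun_prop) (summable_pow_div_Gamma hγ hb (|x₀| + 1)) ?_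
    intro k x hx
    have hG0 := Real.Gamma_pos_of_pos (by positivity : 0 < γ * k + b)
    rw [norm_div, norm_pow, Real.norm_of_nonneg hG0.le]
    gcongr
    simpa using hx
  refine hc.continuousAt (Metric.closedBall_mem_nhds_of_mem ?_)
  simp

theorem mittagLeffler₂_zero {γ b : ℝ} : mittagLeffler₂ γ b 0 = (Real.Gamma b)⁻¹ := by
  unfold mittagLeffler₂
  rw [tsum_eq_single 0 (fun k hk ↦ by simp [hk])]
  simp

theorem mittagLeffler₂_eq_add {γ b : ℝ} (hγ : 0 < γ) (hb : 0 < b) (x : ℝ) :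
    mittagLeffler₂ γ b x = (Real.Gamma b)⁻¹ + x * mittagLeffler₂ γ (γ + b) x := by
  unfold mittagLeffler₂
  rw [(summable_pow_div_Gamma hγ hb x).tsum_eq_zero_add, ← tsum_mul_left]
  congr 1
  · simp
  · refine tsum_congr fun k ↦ ?_
    rw [pow_succ', mul_div_assoc, show γ * ((k + 1 : ℕ) : ℝ) + b = γ * k + (γ + b) by push_cast; ring]

/-- `t^{b-1} E_{γ,b}(-t^γ)`. -/
noncomputable def mlFun (γ b t : ℝ) : ℝ := t ^ (b - 1) * mittagLeffler₂ γ b (-t ^ γ)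

theorem continuousOn_mlFun {γ b : ℝ} (hγ : 0 < γ) (hb : 0 < b) :
    ContinuousOn (mlFun γ b) (Ioi 0) := by
  unfold mlFun
  refine ContinuousOn.mul (fun t ht ↦ ?_)
    ((continuous_mittagLeffler₂ hγ hb).comp_continuousOn fun t ht ↦ ?_)
  · exact (Real.continuousAt_rpow_const _ _ (Or.inl (ne_of_gt ht))).continuousWithinAt
  · exact (Real.continuousAt_rpow_const _ _ (Or.inl (ne_of_gt ht))).continuousWithinAt.neg

theorem rpow_sub_one_mul_pow {γ b t : ℝ} (ht : 0 < t) (k : ℕ) :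
    t ^ (b - 1) * (t ^ γ) ^ k = t ^ (γ * k + b - 1) := by
  rw [← Real.rpow_mul_natCast ht.le, ← Real.rpow_add ht]
  ring_nf

theorem hasSum_mlFun {γ b t : ℝ} (hγ : 0 < γ) (hb : 0 < b) (ht : 0 < t) :
    HasSum (fun k : ℕ ↦ (-1) ^ k * (t ^ (γ * k + b - 1) / Real.Gamma (γ * k + b)))
      (mlFun γ b t) := by
  have h := (summable_pow_div_Gamma hγ hb (-t ^ γ)).hasSum.mul_left (t ^ (b - 1))
  refine h.congr_fun fun k ↦ ?_
  rw [← rpow_sub_one_mul_pow ht, neg_pow (t ^ γ)]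
  ring

/-- The last term is `I^γ` of `mlFun γ b` by the next lemma, so this is a Volterra equation for
`mlFun γ b`. Positivity and the upper bound below use it in that form. -/
theorem mlFun_eq_sub {γ b t : ℝ} (hγ : 0 < γ) (hb : 0 < b) (ht : 0 < t) :
    mlFun γ b t = t ^ (b - 1) / Real.Gamma b - mlFun γ (γ + b) t := by
  unfold mlFun
  rw [mittagLeffler₂_eq_add hγ hb, add_sub_assoc, Real.rpow_add ht]
  ring

/-- Integrate the series term by term with the beta integral. The integrals of the absolute values
form the same Mittag-Leffler series without alternating signs, which still converges. -/
theorem intervalIntegrable_and_fracInt_mlFun {γ a b t : ℝ} (hγ : 0 < γ) (ha : 0 < a)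
    (hb : 0 < b) (ht : 0 < t) :
    IntervalIntegrable (fun s ↦ (t - s) ^ (a - 1) * mlFun γ b s) volume 0 t ∧
      fracInt a (mlFun γ b) t = mlFun γ (a + b) t := by
  have hGa := Real.Gamma_pos_of_pos ha
  have hG (c : ℝ) (hc : 0 < c) (k : ℕ) := Real.Gamma_pos_of_pos (by positivity : 0 < γ * k + c)
  set F : ℕ → ℝ → ℝ := fun k s ↦
    (-1) ^ k * ((t - s) ^ (a - 1) * s ^ (γ * k + b - 1) / Real.Gamma (γ * k + b)) with hF
  have hFi (k : ℕ) : Integrable (F k) (volume.restrict (Ioc 0 t)) := by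
    have := intervalIntegrable_sub_rpow_mul_rpow ha (by positivity : 0 < γ * k + b) ht
    rw [intervalIntegrable_iff_integrableOn_Ioc_of_le ht.le] at this
    exact (this.div_const _).const_mul _
  have hint (k : ℕ) : ∫ s in Ioc 0 t, (t - s) ^ (a - 1) * s ^ (γ * k + b - 1) /
      Real.Gamma (γ * k + b) = Real.Gamma a * (t ^ (γ * k + (a + b) - 1) /
        Real.Gamma (γ * k + (a + b))) := by
    rw [← intervalIntegral.integral_of_le ht.le, intervalIntegral.integral_div,
      integral_sub_rpow_mul_rpow ha (by positivity) ht, show a + (γ * k + b) = γ * k + (a + b) by ring]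
    have := hG b hb k
    field_simp
  have hab : 0 < a + b := by positivity
  have hnorm (k : ℕ) : ∫ s in Ioc 0 t, ‖F k s‖ =
      t ^ (a + b - 1) * Real.Gamma a * ((t ^ γ) ^ k / Real.Gamma (γ * k + (a + b))) := by
    have h1 : ∫ s in Ioc 0 t, ‖F k s‖ = ∫ s in Ioc 0 t, (t - s) ^ (a - 1) * s ^ (γ * k + b - 1) /
      Real.Gamma (γ * k + b) := by
      refine setIntegral_congr_fun measurableSet_Ioc fun s hs ↦ ?_
      have : 0 ≤ t - s := sub_nonneg.2 hs.2
      have := hs.1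
      have := hG b hb k
      simp only [hF, norm_mul, norm_pow, norm_neg, norm_one, one_pow, one_mul]
      rw [Real.norm_of_nonneg (by positivity)]
    rw [h1, hint, ← rpow_sub_one_mul_pow ht]
    ring
  have hsum : Summable fun k ↦ ∫ s in Ioc 0 t, ‖F k s‖ := by
    simp only [hnorm]
    exact (summable_pow_div_Gamma hγ hab _).mul_left _
  have hpt : ∀ s ∈ Ioc 0 t, HasSum (fun k ↦ F k s) ((t - s) ^ (a - 1) * mlFun γ b s) := by
    intro s hs
    refine ((hasSum_mlFun hγ hb hs.1).mul_left ((t - s) ^ (a - 1))).congr_fun fun k ↦ ?_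
    simp only [hF]
    ring
  have hmain := hasSum_integral_of_summable_integral_norm hFi hsum
  have hI : ∫ s in Ioc 0 t, ∑' k, F k s = ∫ s in (0 : ℝ)..t, (t - s) ^ (a - 1) * mlFun γ b s := by
    rw [intervalIntegral.integral_of_le ht.le]
    exact setIntegral_congr_fun measurableSet_Ioc fun s hs ↦ (hpt s hs).tsum_eq
  rw [hI] at hmain
  constructor
  · have h1 := (intervalIntegrable_sub_rpow_mul_rpow ha hb ht).mul_continuousOn
      (g := fun s ↦ mittagLeffler₂ γ b (-s ^ γ)) (((continuous_mittagLeffler₂ hγ hb).comp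
        (Real.continuous_rpow_const hγ.le).neg).continuousOn)
    refine h1.congr fun s _ ↦ ?_
    simp only [mlFun, mul_assoc]
  · have h2 := hmain.mul_left (Real.Gamma a)⁻¹
    refine h2.unique ((hasSum_mlFun hγ hab ht).congr_fun fun k ↦ ?_)
    rw [integral_const_mul, hint]
    field_simp

/-! ### Positivity and bounds -/

/-- The exponent `γ - 1` is negative, so the claim reduces to `t (m - s) ≤ m (t - s)`, that is, `s m
≤ s t`. -/
theorem rpow_sub_le_mul {γ m t s : ℝ} (hγ : γ < 1) (hs : 0 ≤ s) (hsm : s < m) (hmt : m ≤ t) :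
    (t - s) ^ (γ - 1) ≤ t ^ (γ - 1) / m ^ (γ - 1) * (m - s) ^ (γ - 1) := by
  have hm : 0 < m := hs.trans_lt hsm
  have ht : 0 < t := hm.trans_le hmt
  rw [div_mul_eq_mul_div, le_div_iff₀ (by positivity), ← Real.mul_rpow (by linarith) hm.le,
    ← Real.mul_rpow ht.le (by linarith)]
  refine Real.rpow_le_rpow_of_nonpos (mul_pos ht (by linarith)) ?_ (by linarith)
  nlinarith

/-- Write `z` for `mlFun γ γ`, and suppose it has a first zero `t₀`. Let `m` maximise `z` on a short
window ending at `t₀`, and compare the Volterra equations at `t₀` and `m`. On `(0,m)` the kernels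
compare by the factor `q = (t₀/m)^{γ-1}`, which is also the ratio of the forcing terms. The integral
over `(m,t₀)` costs less than `z(m)/2`. Since `q ≥ 1/2`, this gives `z(t₀) > 0`. -/
theorem mlFun_self_pos {γ : ℝ} (hγ : 0 < γ) (hγ1 : γ < 1) {t : ℝ} (ht : 0 < t) :
    0 < mlFun γ γ t := by
  have hG := Real.Gamma_pos_of_pos hγ
  -- Dropping the factor `t^{γ-1}`, singular at `0`, leaves a function continuous up to `0` and
  -- positive there, so the infimum of its nonpositive set is attained at a positive time.
  set P : ℝ → ℝ := fun t ↦ mittagLeffler₂ γ γ (-t ^ γ) with hP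
  have hPc : Continuous P := (continuous_mittagLeffler₂ hγ hγ).comp
    (Real.continuous_rpow_const hγ.le).neg
  have hP0 : 0 < P 0 := by
    simp [hP, Real.zero_rpow hγ.ne', mittagLeffler₂_zero, hG]
  have hz (t : ℝ) : mlFun γ γ t = t ^ (γ - 1) * P t := rfl
  by_contra hneg
  have hPt : P t ≤ 0 := by
    rw [hz] at hneg
    by_contra h
    push Not at h
    exact hneg (by positivity)
  set S : Set ℝ := Ici 0 ∩ P ⁻¹' Iic 0 with hS
  have hSc : IsClosed S := isClosed_Ici.inter (isClosed_Iic.preimage hPc)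
  have hSne : S.Nonempty := ⟨t, ht.le, hPt⟩
  have hSb : BddBelow S := ⟨0, fun x hx ↦ hx.1⟩
  set t₀ := sInf S with ht₀
  have hmem : t₀ ∈ S := hSc.csInf_mem hSne hSb
  have ht₀pos : 0 < t₀ := by
    rcases (mem_Ici.1 hmem.1).eq_or_lt with h | h
    · exact absurd hmem.2 (by rw [← h]; simpa using hP0)
    · exact h
  have hpos : ∀ s, 0 < s → s < t₀ → 0 < mlFun γ γ s := by
    intro s hs hst
    have : s ∉ S := fun h ↦ (csInf_le hSb h).not_gt hst
    have : 0 < P s := by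
      by_contra h
      exact this ⟨hs.le, not_lt.1 h⟩
    rw [hz]
    positivity
  have ht₀le : mlFun γ γ t₀ ≤ 0 := by
    rw [hz]
    exact mul_nonpos_of_nonneg_of_nonpos (by positivity) hmem.2
  have hG1 := Real.Gamma_pos_of_pos (by positivity : 0 < γ + 1)
  -- The bound `ε ≤ t₀/2` yields `q ≥ 1/2`; the bound on `ε^γ` makes the kernel mass over the window
  -- less than `1/2`.
  obtain ⟨ε, hε, hεt, hεs⟩ : ∃ ε, 0 < ε ∧ ε ≤ t₀ / 2 ∧ ε ^ γ / Real.Gamma (γ + 1) < 1 / 2 := by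
    have hc : ContinuousAt (fun ε : ℝ ↦ ε ^ γ / Real.Gamma (γ + 1)) 0 :=
      ((Real.continuous_rpow_const hγ.le).div_const _).continuousAt
    have h1 : ∀ᶠ ε in 𝓝[>] (0 : ℝ), ε ^ γ / Real.Gamma (γ + 1) < 1 / 2 :=
      nhdsWithin_le_nhds (hc.eventually_lt continuousAt_const (by simp [Real.zero_rpow hγ.ne']))
    have h2 : ∀ᶠ ε in 𝓝[>] (0 : ℝ), ε ≤ t₀ / 2 :=
      nhdsWithin_le_nhds (eventually_le_nhds (by positivity))
    obtain ⟨ε, h, h', h''⟩ := (h1.and (h2.and self_mem_nhdsWithin)).exists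
    exact ⟨ε, h'', h', h⟩
  have hcon : ContinuousOn (mlFun γ γ) (Icc (t₀ - ε) t₀) :=
    (continuousOn_mlFun hγ hγ).mono fun s hs ↦ by
      have := hs.1
      simp only [mem_Ioi]
      linarith
  obtain ⟨m, hmI, hmax⟩ := isCompact_Icc.exists_isMaxOn (nonempty_Icc.2 (by linarith)) hcon
  have hzm : 0 < mlFun γ γ m := (hpos (t₀ - ε) (by linarith) (by linarith)).trans_le
    (hmax ⟨le_rfl, by linarith⟩)
  have hmt : m < t₀ := lt_of_le_of_ne hmI.2 fun h ↦ by rw [h] at hzm; linarith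
  have hm1 := hmI.1
  have hm0 : 0 < m := by linarith
  obtain ⟨hi₀, he₀⟩ := intervalIntegrable_and_fracInt_mlFun hγ hγ hγ ht₀pos
  obtain ⟨him, hem⟩ := intervalIntegrable_and_fracInt_mlFun hγ hγ hγ hm0
  have hv₀ := mlFun_eq_sub hγ hγ ht₀pos
  have hvm := mlFun_eq_sub hγ hγ hm0
  rw [← he₀] at hv₀
  rw [← hem] at hvm
  simp only [fracInt, smul_eq_mul] at hv₀ hvm
  have hi1 : IntervalIntegrable (fun s ↦ (t₀ - s) ^ (γ - 1) * mlFun γ γ s) volume 0 m :=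
    hi₀.mono_set (by rw [uIcc_of_le hm0.le, uIcc_of_le ht₀pos.le]; exact Icc_subset_Icc_right hmt.le)
  have hi2 : IntervalIntegrable (fun s ↦ (t₀ - s) ^ (γ - 1) * mlFun γ γ s) volume m t₀ :=
    hi₀.mono_set (by rw [uIcc_of_le hmt.le, uIcc_of_le ht₀pos.le]; exact Icc_subset_Icc_left hm0.le)
  rw [← intervalIntegral.integral_add_adjacent_intervals hi1 hi2] at hv₀
  have hI1 : ∫ s in (0 : ℝ)..m, (t₀ - s) ^ (γ - 1) * mlFun γ γ s ≤
      t₀ ^ (γ - 1) / m ^ (γ - 1) * ∫ s in (0 : ℝ)..m, (m - s) ^ (γ - 1) * mlFun γ γ s := by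
    rw [← intervalIntegral.integral_const_mul]
    refine intervalIntegral.integral_mono_on_of_le_Ioo hm0.le hi1 (him.const_mul _) fun s hs ↦ ?_
    rw [← mul_assoc]
    exact mul_le_mul_of_nonneg_right (rpow_sub_le_mul hγ1 hs.1.le hs.2 hmt.le)
      (hpos s hs.1 (hs.2.trans hmt)).le
  have hI2 : ∫ s in m..t₀, (t₀ - s) ^ (γ - 1) * mlFun γ γ s ≤
      (t₀ - m) ^ γ / γ * mlFun γ γ m := by
    rw [← integral_sub_rpow hγ, ← intervalIntegral.integral_mul_const]
    refine intervalIntegral.integral_mono_on_of_le_Ioo hmt.le hi2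
      ((intervalIntegrable_sub_rpow hγ).mul_const _) fun s hs ↦ ?_
    have : 0 ≤ t₀ - s := by linarith [hs.2]
    exact mul_le_mul_of_nonneg_left (hmax ⟨hm1.trans hs.1.le, hs.2.le⟩) (by positivity)
  set A := ∫ s in (0 : ℝ)..m, (m - s) ^ (γ - 1) * mlFun γ γ s with hA
  set B := ∫ s in (0 : ℝ)..m, (t₀ - s) ^ (γ - 1) * mlFun γ γ s with hB
  set D := ∫ s in m..t₀, (t₀ - s) ^ (γ - 1) * mlFun γ γ s with hD
  set q := t₀ ^ (γ - 1) / m ^ (γ - 1) with hq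
  have hmγ : 0 < m ^ (γ - 1) := by positivity
  have ht₀γ : t₀ ^ (γ - 1) = q * m ^ (γ - 1) := by rw [hq]; field_simp
  have hq2 : 1 / 2 ≤ q := by
    have h1 : t₀ ^ (γ - 1) / m ^ (γ - 1) = (m / t₀) ^ (1 - γ) := by
      rw [← Real.div_rpow ht₀pos.le hm0.le, ← inv_div, Real.inv_rpow (by positivity),
        ← Real.rpow_neg (by positivity), neg_sub]
    have h2 : m / t₀ ≤ 1 := (div_le_one ht₀pos).2 hmt.le
    rw [hq, h1]
    calc 1 / 2 ≤ m / t₀ := by rw [le_div_iff₀ ht₀pos]; linarith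
      _ ≤ _ := Real.self_le_rpow_of_le_one (by positivity) h2 (by linarith)
  have hsmall : (t₀ - m) ^ γ / γ * (Real.Gamma γ)⁻¹ < 1 / 2 := by
    rw [Real.Gamma_add_one hγ.ne'] at hεs
    refine lt_of_le_of_lt ?_ hεs
    rw [div_mul_eq_mul_div, ← div_eq_mul_inv, div_div, mul_comm (Real.Gamma γ)]
    gcongr
    · linarith
  have hA' : (Real.Gamma γ)⁻¹ * A = m ^ (γ - 1) / Real.Gamma γ - mlFun γ γ m := by linarith
  have hB' : (Real.Gamma γ)⁻¹ * B ≤ q * (m ^ (γ - 1) / Real.Gamma γ - mlFun γ γ m) := by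
    rw [← hA']
    calc (Real.Gamma γ)⁻¹ * B ≤ (Real.Gamma γ)⁻¹ * (q * A) := by gcongr
      _ = _ := by ring
  have hD' : (Real.Gamma γ)⁻¹ * D < 1 / 2 * mlFun γ γ m := by
    calc (Real.Gamma γ)⁻¹ * D ≤ (Real.Gamma γ)⁻¹ * ((t₀ - m) ^ γ / γ * mlFun γ γ m) := by gcongr
      _ = (t₀ - m) ^ γ / γ * (Real.Gamma γ)⁻¹ * mlFun γ γ m := by ring
      _ < _ := by gcongr
  have hk : t₀ ^ (γ - 1) / Real.Gamma γ = q * (m ^ (γ - 1) / Real.Gamma γ) := by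
    rw [ht₀γ]; ring
  have : 1 / 2 * mlFun γ γ m ≤ q * mlFun γ γ m := by gcongr
  nlinarith

theorem mittagLeffler_neg_rpow {γ t : ℝ} :
    mittagLeffler γ (-t ^ γ) = mlFun γ 1 t := by
  simp [mlFun, mittagLeffler₂, mittagLeffler]

theorem mlFun_add_one_eq_integral {γ b t : ℝ} (hγ : 0 < γ) (hb : 0 < b) (ht : 0 < t) :
    mlFun γ (1 + b) t = ∫ s in (0 : ℝ)..t, mlFun γ b s := by
  rw [← (intervalIntegrable_and_fracInt_mlFun hγ one_pos hb ht).2]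
  simp [fracInt]

theorem intervalIntegrable_mlFun {γ b t : ℝ} (hγ : 0 < γ) (hb : 0 < b) (ht : 0 < t) :
    IntervalIntegrable (mlFun γ b) volume 0 t := by
  simpa using (intervalIntegrable_and_fracInt_mlFun hγ one_pos hb ht).1

/-- By positivity of `mlFun γ γ`, the function `mlFun γ 1 = 1 - ∫ mlFun γ γ` is nonincreasing.
Replacing it by its endpoint value inside `mlFun γ 1 = 1 - I^γ (mlFun γ 1)` gives a linear
inequality for that value. -/
theorem mlFun_one_le {γ t : ℝ} (hγ : 0 < γ) (hγ1 : γ < 1) (ht : 0 < t) :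
    mlFun γ 1 t ≤ (1 + t ^ γ / Real.Gamma (γ + 1))⁻¹ := by
  have hanti : ∀ s, 0 < s → s ≤ t → mlFun γ 1 t ≤ mlFun γ 1 s := by
    intro s hs hst
    have h1 := mlFun_eq_sub hγ one_pos ht
    have h2 := mlFun_eq_sub hγ one_pos hs
    rw [add_comm γ 1, mlFun_add_one_eq_integral hγ hγ ht] at h1
    rw [add_comm γ 1, mlFun_add_one_eq_integral hγ hγ hs] at h2
    have h3 : ∫ r in (0 : ℝ)..s, mlFun γ γ r ≤ ∫ r in (0 : ℝ)..t, mlFun γ γ r := by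
      refine intervalIntegral.integral_mono_interval le_rfl hs.le hst ?_
        (intervalIntegrable_mlFun hγ hγ ht)
      filter_upwards [self_mem_ae_restrict measurableSet_Ioc] with r hr
      exact (mlFun_self_pos hγ hγ1 hr.1).le
    simp only [sub_self, Real.rpow_zero] at h1 h2
    linarith
  obtain ⟨hi, he⟩ := intervalIntegrable_and_fracInt_mlFun hγ hγ one_pos ht
  have h1 := mlFun_eq_sub hγ one_pos ht
  rw [← he] at h1
  simp only [fracInt, smul_eq_mul, sub_self, Real.rpow_zero, Real.Gamma_one, div_one] at h1
  have hI : t ^ γ / γ * mlFun γ 1 t ≤ ∫ s in (0 : ℝ)..t, (t - s) ^ (γ - 1) * mlFun γ 1 s := by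
    have := integral_sub_rpow (t := t) (c := 0) hγ
    rw [sub_zero] at this
    rw [← this, ← intervalIntegral.integral_mul_const]
    refine intervalIntegral.integral_mono_on_of_le_Ioo ht.le
      ((intervalIntegrable_sub_rpow hγ).mul_const _) hi fun s hs ↦ ?_
    have : 0 ≤ t - s := by linarith [hs.2]
    exact mul_le_mul_of_nonneg_left (hanti s hs.1 hs.2.le) (by positivity)
  have hG := Real.Gamma_pos_of_pos hγ
  rw [Real.Gamma_add_one hγ.ne', ← one_div, le_div_iff₀ (by positivity)]
  have := mul_le_mul_of_nonneg_left hI (inv_nonneg.2 hG.le)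
  have h4 : (Real.Gamma γ)⁻¹ * (t ^ γ / γ * mlFun γ 1 t) =
      mlFun γ 1 t * (t ^ γ / (γ * Real.Gamma γ)) := by field_simp
  linarith

/-- Here `mlFun γ 1 = I^{1-γ} (mlFun γ γ)`, whose kernel is at least `t^{-γ}`, while `∫ mlFun γ γ =
1 - mlFun γ 1`. -/
theorem le_mlFun_one {γ t : ℝ} (hγ : 0 < γ) (hγ1 : γ < 1) (ht : 0 < t) :
    (1 + Real.Gamma (1 - γ) * t ^ γ)⁻¹ ≤ mlFun γ 1 t := by
  have hγ' : 0 < 1 - γ := by linarith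
  have hG := Real.Gamma_pos_of_pos hγ'
  have h1 := mlFun_eq_sub hγ one_pos ht
  rw [add_comm γ 1, mlFun_add_one_eq_integral hγ hγ ht] at h1
  simp only [sub_self, Real.rpow_zero, Real.Gamma_one, div_one] at h1
  obtain ⟨hi, he⟩ := intervalIntegrable_and_fracInt_mlFun hγ hγ' hγ ht
  rw [sub_add_cancel] at he
  simp only [fracInt, smul_eq_mul] at he
  have hI : t ^ (-γ) * ∫ s in (0 : ℝ)..t, mlFun γ γ s ≤
      ∫ s in (0 : ℝ)..t, (t - s) ^ (1 - γ - 1) * mlFun γ γ s := by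
    rw [← intervalIntegral.integral_const_mul]
    refine intervalIntegral.integral_mono_on_of_le_Ioo ht.le
      ((intervalIntegrable_mlFun hγ hγ ht).const_mul _) hi fun s hs ↦ ?_
    refine mul_le_mul_of_nonneg_right ?_ (mlFun_self_pos hγ hγ1 hs.1).le
    rw [show 1 - γ - 1 = -γ by ring]
    exact Real.rpow_le_rpow_of_nonpos (by linarith [hs.2]) (by linarith [hs.1]) (by linarith)
  have h2 : ∫ s in (0 : ℝ)..t, mlFun γ γ s = 1 - mlFun γ 1 t := by linarith
  rw [h2] at hI
  have htγ : t ^ (-γ) * t ^ γ = 1 := by rw [← Real.rpow_add ht]; simp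
  rw [← one_div, div_le_iff₀ (by positivity)]
  have h3 : t ^ (-γ) * (1 - mlFun γ 1 t) ≤ Real.Gamma (1 - γ) * mlFun γ 1 t := by
    rw [← he, ← mul_assoc, mul_inv_cancel₀ hG.ne', one_mul]
    rwa [he]
  have h4 := mul_le_mul_of_nonneg_right h3 (by positivity : 0 ≤ t ^ γ)
  have h5 : t ^ (-γ) * (1 - mlFun γ 1 t) * t ^ γ = 1 - mlFun γ 1 t := by
    linear_combination (1 - mlFun γ 1 t) * htγ
  linarith

/-- `E_{γ,1}` on the negative half-line lies between two multiples of `1 / (1 + x)`. -/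
theorem mittagLeffler_neg_bounds {γ x : ℝ} (hγ : 0 < γ) (hγ1 : γ < 1) (hx : 0 ≤ x) :
    (1 + Real.Gamma (1 - γ) * x)⁻¹ ≤ mittagLeffler γ (-x) ∧
      mittagLeffler γ (-x) ≤ (1 + x / Real.Gamma (γ + 1))⁻¹ := by
  rcases hx.eq_or_lt with rfl | hx
  · have : mittagLeffler γ 0 = 1 := by
      have := mittagLeffler₂_zero (γ := γ) (b := 1)
      simpa [mittagLeffler₂, mittagLeffler] using this
    simp [this]
  · have ht : 0 < x ^ γ⁻¹ := by positivity
    have hxt : (x ^ γ⁻¹) ^ γ = x := Real.rpow_inv_rpow hx.le hγ.ne'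
    have h1 := le_mlFun_one hγ hγ1 ht
    have h2 := mlFun_one_le hγ hγ1 ht
    rw [← mittagLeffler_neg_rpow, hxt] at h1 h2
    exact ⟨h1, h2⟩

/-! ### Inverting the Caputo derivative -/

section FracInt

variable {F : Type*} [NormedAddCommGroup F] [NormedSpace ℝ F]

theorem integral_sub_rpow_mul_sub_rpow {a b s t : ℝ} (ha : 0 < a) (hb : 0 < b) (hst : s < t) :
    ∫ r in s..t, (t - r) ^ (a - 1) * (r - s) ^ (b - 1) =
      Real.Gamma a * Real.Gamma b / Real.Gamma (a + b) * (t - s) ^ (a + b - 1) := by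
  rw [← integral_sub_rpow_mul_rpow ha hb (sub_pos.2 hst)]
  have := intervalIntegral.integral_comp_sub_right (a := s) (b := t)
    (fun r : ℝ ↦ (t - s - r) ^ (a - 1) * r ^ (b - 1)) s
  simp only [sub_self, sub_sub_sub_cancel_right] at this
  exact this

theorem intervalIntegrable_sub_rpow_mul_sub_rpow {a b s t : ℝ} (ha : 0 < a) (hb : 0 < b)
    (hst : s < t) :
    IntervalIntegrable (fun r ↦ (t - r) ^ (a - 1) * (r - s) ^ (b - 1)) volume s t := by
  refine intervalIntegral.intervalIntegrable_of_integral_ne_zero ?_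
  rw [integral_sub_rpow_mul_sub_rpow ha hb hst]
  have := Real.Gamma_pos_of_pos ha
  have := Real.Gamma_pos_of_pos hb
  have := Real.Gamma_pos_of_pos (add_pos ha hb)
  have := sub_pos.2 hst
  positivity

theorem aestronglyMeasurable_of_rpow_smul {c t : ℝ} {f : ℝ → F} (ht : 0 < t)
    (hf : IntervalIntegrable (fun s ↦ (t - s) ^ c • f s) volume 0 t) :
    AEStronglyMeasurable f (volume.restrict (Ioc 0 t)) := by
  rw [intervalIntegrable_iff_integrableOn_Ioc_of_le ht.le] at hf
  have hm : AEStronglyMeasurable (fun s : ℝ ↦ (t - s) ^ (-c)) (volume.restrict (Ioc 0 t)) :=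
    (by fun_prop : Measurable fun s : ℝ ↦ (t - s) ^ (-c)).aestronglyMeasurable
  refine (hm.smul hf.1).congr ?_
  filter_upwards [self_mem_ae_restrict measurableSet_Ioc,
    ae_restrict_of_ae (Measure.ae_ne volume t)] with s hs hst
  have : 0 < t - s := sub_pos.2 (lt_of_le_of_ne hs.2 hst)
  simp only [Pi.smul_apply', smul_smul]
  rw [← Real.rpow_add this]
  simp

theorem intervalIntegrable_sub_rpow_smul {a t : ℝ} (ha : 0 < a) (ht : 0 ≤ t) {f : ℝ → F}
    (hf : ContinuousOn f (Icc 0 t)) :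
    IntervalIntegrable (fun s ↦ (t - s) ^ (a - 1) • f s) volume 0 t :=
  (intervalIntegrable_sub_rpow ha).smul_continuousOn (by rwa [uIcc_of_le ht])

theorem norm_fracInt_le {a t : ℝ} (ha : 0 < a) (ht : 0 ≤ t) {f : ℝ → F} {B : ℝ → ℝ}
    (hB : ContinuousOn B (Icc 0 t)) (h : ∀ s ∈ Ioo 0 t, ‖f s‖ ≤ B s) :
    ‖fracInt a f t‖ ≤ fracInt a B t := by
  have hG := Real.Gamma_pos_of_pos ha
  unfold fracInt
  rw [norm_smul, Real.norm_of_nonneg (by positivity), smul_eq_mul]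
  gcongr
  refine intervalIntegral.norm_integral_le_of_norm_le ht ?_
    (intervalIntegrable_sub_rpow_smul ha ht hB)
  filter_upwards [Measure.ae_ne volume t] with s hst hs
  have h1 : s < t := lt_of_le_of_ne hs.2 hst
  have : 0 ≤ t - s := by linarith
  rw [norm_smul, Real.norm_of_nonneg (by positivity), smul_eq_mul]
  exact mul_le_mul_of_nonneg_left (h s ⟨hs.1, h1⟩) (by positivity)

theorem fracInt_sub {a t : ℝ} (ha : 0 < a) (ht : 0 ≤ t) {f g : ℝ → F}
    (hf : ContinuousOn f (Icc 0 t)) (hg : ContinuousOn g (Icc 0 t)) :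
    fracInt a (fun s ↦ f s - g s) t = fracInt a f t - fracInt a g t := by
  unfold fracInt
  simp only [smul_sub]
  rw [intervalIntegral.integral_sub (intervalIntegrable_sub_rpow_smul ha ht hf)
    (intervalIntegrable_sub_rpow_smul ha ht hg), smul_sub]

theorem fracInt_sum {ι : Type*} {a t : ℝ} (ha : 0 < a) (ht : 0 ≤ t) (S : Finset ι) {f : ι → ℝ → F}
    (hf : ∀ i, ContinuousOn (f i) (Icc 0 t)) :
    fracInt a (fun s ↦ ∑ i ∈ S, f i s) t = ∑ i ∈ S, fracInt a (f i) t := by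
  unfold fracInt
  simp only [Finset.smul_sum]
  rw [intervalIntegral.integral_finsetSum fun i _ ↦ intervalIntegrable_sub_rpow_smul ha ht (hf i),
    Finset.smul_sum]

variable [CompleteSpace F]

/-- Fubini on the triangle `s < r ≤ t`: the inner integral in `r` is a beta integral. The same
computation with norms shows that integrability against the kernel of order `a + b` suffices. -/
theorem fracInt_fracInt {a b t : ℝ} {f : ℝ → F} (ha : 0 < a) (hb : 0 < b) (ht : 0 < t)
    (hf : IntervalIntegrable (fun s ↦ (t - s) ^ (a + b - 1) • f s) volume 0 t) :
    fracInt a (fracInt b f) t = fracInt (a + b) f t := by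
  have hfm := aestronglyMeasurable_of_rpow_smul ht hf
  rw [intervalIntegrable_iff_integrableOn_Ioc_of_le ht.le] at hf
  set μ := volume.restrict (Ioc (0 : ℝ) t) with hμ
  set k : ℝ → ℝ → ℝ := fun r s ↦ (t - r) ^ (a - 1) * (r - s) ^ (b - 1) with hk
  set G : ℝ → ℝ → F := fun r s ↦ {p : ℝ × ℝ | p.2 < p.1}.indicator
    (fun p ↦ k p.1 p.2 • f p.2) (r, s) with hG
  have hGs (s r : ℝ) : G r s = (Ioi s).indicator (fun r ↦ k r s • f s) r := by
    simp [hG, indicator]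
  have hGr (s r : ℝ) : G r s = (Iio r).indicator (fun s ↦ k r s • f s) s := by
    simp [hG, indicator]
  have hset (s : ℝ) (hs : s ∈ Ioc 0 t) : Ioi s ∩ Ioc 0 t = Ioc s t := by
    ext r; simp only [mem_inter_iff, mem_Ioi, mem_Ioc] at *; constructor <;> intro h <;>
      (try constructor) <;> (try constructor) <;> linarith [h.1, h.2, hs.1, hs.2]
  have hset' (r : ℝ) (hr : r ∈ Ioc 0 t) : Iio r ∩ Ioc 0 t = Ioo 0 r := by
    ext s; simp only [mem_inter_iff, mem_Iio, mem_Ioc, mem_Ioo] at *; constructor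
    · intro h; exact ⟨h.2.1, h.1⟩
    · intro h; exact ⟨h.2, h.1, h.2.le.trans hr.2⟩
  have hki (s : ℝ) (hst : s < t) : IntegrableOn (fun r ↦ k r s) (Ioc s t) := by
    have := intervalIntegrable_sub_rpow_mul_sub_rpow ha hb hst
    rwa [intervalIntegrable_iff_integrableOn_Ioc_of_le hst.le] at this
  have hkv (s : ℝ) (hst : s < t) : ∫ r in Ioc s t, k r s =
      Real.Gamma a * Real.Gamma b / Real.Gamma (a + b) * (t - s) ^ (a + b - 1) := by
    rw [← intervalIntegral.integral_of_le hst.le, integral_sub_rpow_mul_sub_rpow ha hb hst]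
  have hGm : AEStronglyMeasurable (Function.uncurry G) (μ.prod μ) := by
    have h1 : AEStronglyMeasurable (fun p : ℝ × ℝ ↦ k p.1 p.2 • f p.2) (μ.prod μ) :=
      (by fun_prop : Measurable fun p : ℝ × ℝ ↦ k p.1 p.2).aestronglyMeasurable.smul hfm.comp_snd
    exact h1.indicator (measurableSet_lt measurable_snd measurable_fst)
  have hne : ∀ᵐ s ∂μ, s ∈ Ioc 0 t ∧ s < t := by
    filter_upwards [self_mem_ae_restrict measurableSet_Ioc,
      ae_restrict_of_ae (Measure.ae_ne volume t)] with s hs hst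
    exact ⟨hs, lt_of_le_of_ne hs.2 hst⟩
  have hint : Integrable (Function.uncurry G) (μ.prod μ) := by
    refine (integrable_prod_iff' hGm).2 ⟨?_, ?_⟩
    · filter_upwards [hne] with s hs
      simp only [Function.uncurry, hGs]
      rw [integrable_indicator_iff measurableSet_Ioi, IntegrableOn, hμ,
        Measure.restrict_restrict measurableSet_Ioi, hset s hs.1]
      exact (hki s hs.2).smul_const _
    · refine (hf.norm.const_mul (Real.Gamma a * Real.Gamma b / Real.Gamma (a + b))).congr ?_
      filter_upwards [hne] with s hs
      simp only [Function.uncurry, hGs, norm_indicator_eq_indicator_norm]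
      rw [integral_indicator measurableSet_Ioi, hμ, Measure.restrict_restrict measurableSet_Ioi,
        hset s hs.1]
      simp only [norm_smul]
      rw [integral_mul_const, Real.norm_of_nonneg
        (Real.rpow_nonneg (by linarith [hs.2]) _), ← mul_assoc, ← hkv s hs.2]
      congr 1
      refine setIntegral_congr_fun measurableSet_Ioc fun r hr ↦ ?_
      have h1 : 0 ≤ t - r := by linarith [hr.2]
      have h2 : 0 ≤ r - s := by linarith [hr.1]
      exact (Real.norm_of_nonneg (by positivity)).symm
  have hswap := integral_integral_swap hint
  have hL : ∫ r, ∫ s, G r s ∂μ ∂μ =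
      ∫ r in (0 : ℝ)..t, (t - r) ^ (a - 1) • ∫ s in (0 : ℝ)..r, (r - s) ^ (b - 1) • f s := by
    rw [intervalIntegral.integral_of_le ht.le]
    refine setIntegral_congr_fun measurableSet_Ioc fun r hr ↦ ?_
    simp only [hGr]
    rw [integral_indicator measurableSet_Iio, hμ, Measure.restrict_restrict measurableSet_Iio,
      hset' r hr, ← integral_Ioc_eq_integral_Ioo, intervalIntegral.integral_of_le hr.1.le,
      ← integral_smul]
    simp only [hk, smul_smul]
  have hR : ∫ s, ∫ r, G r s ∂μ ∂μ = (Real.Gamma a * Real.Gamma b / Real.Gamma (a + b)) •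
      ∫ s in (0 : ℝ)..t, (t - s) ^ (a + b - 1) • f s := by
    rw [intervalIntegral.integral_of_le ht.le, ← integral_smul]
    refine integral_congr_ae ?_
    filter_upwards [hne] with s hs
    simp only [hGs]
    rw [integral_indicator measurableSet_Ioi, hμ, Measure.restrict_restrict measurableSet_Ioi,
      hset s hs.1, integral_smul_const, hkv s hs.2, smul_smul]
  unfold fracInt
  have hGa := (Real.Gamma_pos_of_pos ha).ne'
  have hGb := (Real.Gamma_pos_of_pos hb).ne'
  have h1 (r : ℝ) : (t - r) ^ (a - 1) • (Real.Gamma b)⁻¹ •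
      ∫ s in (0 : ℝ)..r, (r - s) ^ (b - 1) • f s = (Real.Gamma b)⁻¹ • ((t - r) ^ (a - 1) •
      ∫ s in (0 : ℝ)..r, (r - s) ^ (b - 1) • f s) := smul_comm _ _ _
  simp only [h1]
  rw [intervalIntegral.integral_smul, ← hL, hswap, hR, smul_smul, smul_smul]
  congr 1
  field_simp

/-- The orders `γ` and `1 - γ` add up to one, so the composition is the ordinary integral of `deriv
v`. -/
theorem sub_eq_fracInt_caputo {γ T : ℝ} (hγ : 0 < γ) (hγ1 : γ < 1) {v : ℝ → F}
    (hc : ContinuousOn v (Icc 0 T)) (hd : ∀ t ∈ Ioo 0 T, DifferentiableAt ℝ v t)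
    (hi : ∀ t ∈ Ioo 0 T, IntervalIntegrable (fun s ↦ (t - s) ^ (-γ) • deriv v s) volume 0 t)
    {t : ℝ} (ht : t ∈ Ioo 0 T) :
    v t - v 0 = fracInt γ (fracInt (1 - γ) (deriv v)) t := by
  have hγ' : 0 < 1 - γ := by linarith
  -- Multiplying the integrable function `(t-s)^{-γ} v'(s)` by the continuous factor `(t-s)^γ`
  -- removes the weight off the null set `{t}`.
  have hdi : IntervalIntegrable (deriv v) volume 0 t := by
    have h := hi t ht
    have hcγ : ContinuousOn (fun s : ℝ ↦ (t - s) ^ γ) (uIcc 0 t) :=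
      ((Real.continuous_rpow_const hγ.le).comp (continuous_const.sub continuous_id)).continuousOn
    have h2 := h.continuousOn_smul hcγ
    refine h2.congr_ae ?_
    rw [uIoc_of_le ht.1.le]
    filter_upwards [self_mem_ae_restrict measurableSet_Ioc,
      ae_restrict_of_ae (Measure.ae_ne volume t)] with s hs hst
    have : 0 < t - s := sub_pos.2 (lt_of_le_of_ne hs.2 hst)
    rw [smul_smul, ← Real.rpow_add this]
    simp
  rw [fracInt_fracInt hγ hγ' ht.1 (by simpa using hdi)]
  have h3 := intervalIntegral.integral_eq_sub_of_hasDerivAt_of_le ht.1.le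
    (hc.mono (Icc_subset_Icc_right ht.2.le))
    (fun s hs ↦ (hd s ⟨hs.1, hs.2.trans ht.2⟩).hasDerivAt) hdi
  simp [fracInt, h3]

theorem fracInt_smul_const {a t : ℝ} (f : ℝ → ℝ) (x : F) :
    fracInt a (fun s ↦ f s • x) t = fracInt a f t • x := by
  unfold fracInt
  simp only [smul_smul, smul_eq_mul]
  rw [intervalIntegral.integral_smul_const, smul_smul]

theorem fracInt_const_mul {a t c : ℝ} (f : ℝ → ℝ) :
    fracInt a (fun s ↦ c * f s) t = c * fracInt a f t := by
  have := fracInt_smul_const (a := a) (t := t) f c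
  simpa only [smul_eq_mul, mul_comm] using this

/-- Iterating `v k = v k 0 - I^γ (v (k + 1))` gives a Taylor expansion in powers of `t ^ γ`. -/
theorem norm_sub_sum_le_of_volterra {γ T M R : ℝ} (hγ : 0 < γ) {v : ℕ → ℝ → F}
    (hc : ∀ k, ContinuousOn (v k) (Icc 0 T)) (hb : ∀ k, ∀ t ∈ Icc 0 T, ‖v k t‖ ≤ M * R ^ k)
    (hv : ∀ k, ∀ t ∈ Ioo 0 T, v k t = v k 0 - fracInt γ (v (k + 1)) t) (N k : ℕ) {t : ℝ}
    (ht : t ∈ Ioo 0 T) :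
    ‖v k t - ∑ j ∈ Finset.range N, (t ^ (γ * j) / Real.Gamma (γ * j + 1)) • (-1 : ℝ) ^ j •
      v (k + j) 0‖ ≤ M * R ^ (k + N) * (t ^ (γ * N) / Real.Gamma (γ * N + 1)) := by
  have hI (j : ℕ) {t : ℝ} (ht : 0 < t) :
      fracInt γ (fun s ↦ s ^ (γ * j) / Real.Gamma (γ * j + 1)) t =
        t ^ (γ * (j + 1 : ℕ)) / Real.Gamma (γ * (j + 1 : ℕ) + 1) := by
    have := fracInt_rpow hγ (by positivity : 0 < γ * j + 1) ht
    rw [show γ * ((j + 1 : ℕ) : ℝ) = γ + γ * j by push_cast; ring]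
    simp only [← add_assoc, add_sub_cancel_right] at this
    exact this
  have hcont (j : ℕ) : Continuous fun s : ℝ ↦ s ^ (γ * j) / Real.Gamma (γ * j + 1) :=
    (Real.continuous_rpow_const (by positivity)).div_const _
  induction N generalizing k t with
  | zero => simpa using hb k t (Ioo_subset_Icc_self ht)
  | succ N ih =>
    have hsub : Icc 0 t ⊆ Icc 0 T := Icc_subset_Icc_right ht.2.le
    -- The remainder of order `N + 1` for `v k` is `-I^γ` of the remainder of order `N` for `v (k +
    -- 1)`.
    have key : v k t - ∑ j ∈ Finset.range (N + 1),
        (t ^ (γ * j) / Real.Gamma (γ * j + 1)) • (-1 : ℝ) ^ j • v (k + j) 0 =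
        - fracInt γ (fun s ↦ v (k + 1) s - ∑ j ∈ Finset.range N,
          (s ^ (γ * j) / Real.Gamma (γ * j + 1)) • (-1 : ℝ) ^ j • v (k + 1 + j) 0) t := by
      have hcs (j : ℕ) : Continuous fun s : ℝ ↦
          (s ^ (γ * j) / Real.Gamma (γ * j + 1)) • (-1 : ℝ) ^ j • v (k + 1 + j) 0 :=
        (hcont j).smul continuous_const
      rw [fracInt_sub hγ ht.1.le ((hc _).mono hsub)
        (continuous_finsetSum _ fun j _ ↦ hcs j).continuousOn,
        fracInt_sum hγ ht.1.le _ fun j ↦ (hcs j).continuousOn]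
      simp only [fracInt_smul_const, hI _ ht.1]
      rw [Finset.sum_range_succ', hv k t ht]
      simp only [pow_succ, Nat.cast_zero, mul_zero, Real.rpow_zero, zero_add, Real.Gamma_one,
        div_one, pow_zero, one_smul, add_zero, mul_neg, mul_one, neg_smul, smul_neg,
        Finset.sum_neg_distrib]
      simp only [add_assoc, add_comm 1]
      abel
    rw [key, norm_neg]
    refine (norm_fracInt_le hγ ht.1.le (B := fun s ↦ M * R ^ (k + 1 + N) *
      (s ^ (γ * N) / Real.Gamma (γ * N + 1))) (continuous_const.mul (hcont N)).continuousOn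
      fun s hs ↦ ih (k + 1) ⟨hs.1, hs.2.trans ht.2⟩).trans_eq ?_
    rw [fracInt_const_mul, hI N ht.1, show k + 1 + N = k + (N + 1) by ring]

/-- The Taylor remainder is bounded by the general term of a convergent Mittag-Leffler series, hence
tends to zero. -/
theorem hasSum_of_volterra {γ T M R : ℝ} (hγ : 0 < γ) {v : ℕ → ℝ → F}
    (hc : ∀ k, ContinuousOn (v k) (Icc 0 T)) (hb : ∀ k, ∀ t ∈ Icc 0 T, ‖v k t‖ ≤ M * R ^ k)
    (hv : ∀ k, ∀ t ∈ Ioo 0 T, v k t = v k 0 - fracInt γ (v (k + 1)) t) {t : ℝ}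
    (ht : t ∈ Ioc 0 T) :
    HasSum (fun j : ℕ ↦ (t ^ (γ * j) / Real.Gamma (γ * j + 1)) • (-1 : ℝ) ^ j • v j 0) (v 0 t) := by
  have hT : 0 < T := ht.1.trans_le ht.2
  have hcont (j : ℕ) : Continuous fun s : ℝ ↦ s ^ (γ * j) / Real.Gamma (γ * j + 1) :=
    (Real.continuous_rpow_const (by positivity)).div_const _
  have hG (j : ℕ) := Real.Gamma_pos_of_pos (by positivity : 0 < γ * j + 1)
  have hle (N : ℕ) : ‖v 0 t - ∑ j ∈ Finset.range N, (t ^ (γ * j) / Real.Gamma (γ * j + 1)) •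
      (-1 : ℝ) ^ j • v j 0‖ ≤ M * R ^ N * (t ^ (γ * N) / Real.Gamma (γ * N + 1)) := by
    have hcl : closure (Ioo 0 T) = Icc 0 T := closure_Ioo hT.ne
    have htc : t ∈ closure (Ioo 0 T) := hcl ▸ Ioc_subset_Icc_self ht
    -- The Volterra relation is available only on the open interval; continuity carries the estimate
    -- to `t = T`.
    refine le_on_closure (f := fun t ↦ ‖v 0 t - ∑ j ∈ Finset.range N,
      (t ^ (γ * j) / Real.Gamma (γ * j + 1)) • (-1 : ℝ) ^ j • v j 0‖)
      (g := fun t ↦ M * R ^ N * (t ^ (γ * N) / Real.Gamma (γ * N + 1)))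
      (fun s hs ↦ ?_) ?_ ?_ htc
    · have := norm_sub_sum_le_of_volterra hγ hc hb hv N 0 hs
      simpa using this
    · rw [hcl]
      refine ((hc 0).sub ?_).norm
      exact (continuous_finsetSum _ fun j _ ↦ (hcont j).smul continuous_const).continuousOn
    · exact (continuous_const.mul (hcont N)).continuousOn
  have hs : Summable fun j : ℕ ↦ M * R ^ j * (t ^ (γ * j) / Real.Gamma (γ * j + 1)) := by
    refine ((summable_pow_div_Gamma hγ one_pos (R * t ^ γ)).mul_left M).congr fun j ↦ ?_
    rw [mul_pow, ← Real.rpow_mul_natCast ht.1.le]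
    ring
  have hsum : Summable fun j : ℕ ↦
      (t ^ (γ * j) / Real.Gamma (γ * j + 1)) • (-1 : ℝ) ^ j • v j 0 := by
    refine Summable.of_norm_bounded hs fun j ↦ ?_
    have h0 := hb j 0 ⟨le_rfl, hT.le⟩
    have := ht.1
    have := hG j
    rw [norm_smul, norm_smul, norm_pow, norm_neg, norm_one, one_pow, one_mul,
      Real.norm_of_nonneg (by positivity), mul_comm]
    gcongr
  have h1 := hsum.hasSum.tendsto_sum_nat
  have h2 : Tendsto (fun N ↦ ∑ j ∈ Finset.range N, (t ^ (γ * j) / Real.Gamma (γ * j + 1)) •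
      (-1 : ℝ) ^ j • v j 0) atTop (𝓝 (v 0 t)) := by
    rw [tendsto_iff_norm_sub_tendsto_zero]
    refine squeeze_zero (fun _ ↦ norm_nonneg _) (fun N ↦ ?_) hs.tendsto_atTop_zero
    rw [norm_sub_rev]
    exact hle N
  rw [← tendsto_nhds_unique h1 h2]
  exact hsum.hasSum

end FracInt

/-! ### The equation on the Fourier side -/

section Fourier

variable {n : ℕ}

/-- The symbol of `-Δ` for Mathlib's Fourier transform. -/
noncomputable def negLaplacianSymbol (η : V n) : ℝ := (2 * Real.pi) ^ 2 * ‖η‖ ^ 2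

theorem negLaplacianSymbol_nonneg (η : V n) : 0 ≤ negLaplacianSymbol η := by
  unfold negLaplacianSymbol; positivity

theorem continuous_negLaplacianSymbol : Continuous (negLaplacianSymbol (n := n)) := by
  unfold negLaplacianSymbol; fun_prop

/-- The Laplacian of tempered distributions is a Fourier multiplier, and both sides are locally
integrable, so testing against smooth compactly supported functions identifies them almost
everywhere. -/
theorem fourier_eq_of_eq_laplacian {f w : L2 n}
    (h : ((w : L2 n) : 𝓢'(V n, ℂ)) = Δ ((f : L2 n) : 𝓢'(V n, ℂ))) :
    (𝓕 w : L2 n) =ᵐ[volume] fun η ↦ -(negLaplacianSymbol η • (𝓕 f : L2 n) η) := by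
  have h1 := congrArg (fun S : 𝓢'(V n, ℂ) ↦ 𝓕 S) h
  rw [TemperedDistribution.laplacian_eq_fourierMultiplierCLM,
    TemperedDistribution.fourierMultiplierCLM_apply, ← Complex.coe_smul,
    FourierTransform.fourier_smul, FourierTransform.fourier_fourierInv_eq,
    Lp.fourier_toTemperedDistribution_eq, Lp.fourier_toTemperedDistribution_eq] at h1
  have hloc (f : L2 n) : LocallyIntegrable f volume := (Lp.memLp f).locallyIntegrable (by norm_num)
  have hlocR : LocallyIntegrable (fun η ↦ -(negLaplacianSymbol η • (𝓕 f : L2 n) η)) volume :=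
    ((hloc _).continuous_smul continuous_negLaplacianSymbol).neg
  refine ae_eq_of_integral_contDiff_smul_eq (hloc _) hlocR fun φ hφ hφc ↦ ?_
  have hg₁ : HasCompactSupport (Complex.ofRealCLM ∘ φ) := hφc.comp_left rfl
  have hg₂ : ContDiff ℝ (⊤ : ℕ∞) (Complex.ofRealCLM ∘ φ) := by fun_prop
  have h2 := congrArg (fun S : 𝓢'(V n, ℂ) ↦ S (hg₁.toSchwartzMap hg₂)) h1
  have htg : (fun x : V n ↦ Complex.ofReal (‖x‖ ^ 2)).HasTemperateGrowth := by fun_prop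
  simp only [Lp.toTemperedDistribution_apply] at h2
  rw [_root_.smul_apply, TemperedDistribution.smulLeftCLM_apply_apply,
    Lp.toTemperedDistribution_apply, ← integral_smul] at h2
  refine Eq.trans (integral_congr_ae (Eventually.of_forall fun η ↦ ?_))
    (h2.trans (integral_congr_ae (Eventually.of_forall fun η ↦ ?_)))
  · simp
  · simp only [SchwartzMap.smulLeftCLM_apply_apply htg]
    simp [negLaplacianSymbol]
    ring

theorem integrableOn_fourier (f : L2 n) {B : Set (V n)} (hB : volume B ≠ ⊤) :
    IntegrableOn (𝓕 f : L2 n) B volume :=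
  integrableOn_Lp_of_measure_ne_top _ (by norm_num) hB

/-- The functional `f ↦ ∫_B (4π²|η|²)^k 𝓕 f`, for `B` in the ball of radius `R`. -/
theorem exists_momentCLM {B : Set (V n)} (hB : MeasurableSet B) {R : ℝ}
    (hBR : B ⊆ Metric.closedBall 0 R) :
    ∃ (ℓ : ℕ → L2 n →L[ℝ] ℂ) (M : ℝ), (∀ k f, ℓ k f = ∫ η in B, negLaplacianSymbol η ^ k •
      (𝓕 f : L2 n) η) ∧ ∀ k, ‖ℓ k‖ ≤ M * ((2 * Real.pi) ^ 2 * R ^ 2) ^ k := by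
  have hBfin : volume B < ⊤ := (measure_mono hBR).trans_lt measure_closedBall_lt_top
  set A := (2 * Real.pi) ^ 2 * R ^ 2 with hA
  have hle : ∀ η ∈ B, negLaplacianSymbol η ≤ A := fun η hη ↦ by
    have : ‖η‖ ≤ R := by simpa using hBR hη
    rw [negLaplacianSymbol, hA]
    gcongr
  set χ : ℕ → V n → ℂ := fun k ↦ B.indicator fun η ↦ ((negLaplacianSymbol η ^ k : ℝ) : ℂ) with hχ
  have hχm (k : ℕ) : AEStronglyMeasurable (χ k) volume :=
    ((Complex.continuous_ofReal.comp
      (continuous_negLaplacianSymbol.pow k)).aestronglyMeasurable).indicator hB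
  have hpt (k : ℕ) (η : V n) : ‖χ k η‖ ≤ A ^ k * ‖χ 0 η‖ := by
    by_cases hη : η ∈ B
    · simp only [hχ, indicator_of_mem hη, Complex.norm_real, pow_zero, norm_one, mul_one, norm_pow]
      rw [Real.norm_of_nonneg (negLaplacianSymbol_nonneg η)]
      exact pow_le_pow_left₀ (negLaplacianSymbol_nonneg η) (hle η hη) k
    · simp [hχ, hη]
  have h0 : MemLp (χ 0) 2 volume := by
    simp only [hχ, pow_zero, Complex.ofReal_one]
    exact memLp_indicator_const 2 hB 1 (Or.inr hBfin.ne)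
  have hmem (k : ℕ) : MemLp (χ k) 2 volume := h0.of_le_mul (hχm k) (Eventually.of_forall (hpt k))
  -- The moment is the `L²` inner product of `𝓕 f` with the truncated power `χ k`. Its norm bound
  -- follows from Plancherel and `‖χ k‖ ≤ A^k ‖χ 0‖` pointwise.
  refine ⟨fun k ↦ ((innerSL ℂ (hmem k).toLp).restrictScalars ℝ).comp
    ((Lp.fourierTransformₗᵢ (V n) ℂ).toContinuousLinearEquiv.toContinuousLinearMap.restrictScalars
      ℝ), ‖h0.toLp‖, fun k f ↦ ?_, fun k ↦ ?_⟩
  · change inner ℂ (hmem k).toLp (𝓕 f) = _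
    rw [L2.inner_def, ← integral_indicator hB]
    refine integral_congr_ae ?_
    filter_upwards [(hmem k).coeFn_toLp] with η hη
    rw [hη]
    by_cases hηB : η ∈ B
    · simp only [hχ, indicator_of_mem hηB, RCLike.inner_apply, Complex.conj_ofReal,
        Complex.real_smul, mul_comm]
    · simp [hχ, hηB]
  · refine ContinuousLinearMap.opNorm_le_bound _ (by positivity) fun f ↦ ?_
    change ‖inner ℂ (hmem k).toLp (𝓕 f)‖ ≤ _
    refine (norm_inner_le_norm _ _).trans ?_
    rw [Lp.norm_fourier_eq, mul_comm ‖h0.toLp‖]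
    gcongr
    refine Lp.norm_le_mul_norm_of_ae_le_mul ?_
    filter_upwards [(hmem k).coeFn_toLp, h0.coeFn_toLp] with η h1 h2
    rw [h1, h2]
    exact hpt k η

theorem continuous_mittagLeffler {γ : ℝ} (hγ : 0 < γ) : Continuous (mittagLeffler γ) :=
  continuous_mittagLeffler₂ hγ one_pos

/-- The time derivative of `u` exists only in `L²`, so the equation is tested with bounded
functionals instead of being solved at each frequency. Boundedness of `B` gives the moments
geometric growth, as `hasSum_of_volterra` requires. -/
theorem setIntegral_fourier_solution {γ T : ℝ} (hγ : 0 < γ) (hγ1 : γ < 1) {u : ℝ → L2 n}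
    {g : L2 n} (hu : IsSolution γ T u g) {B : Set (V n)} (hB : MeasurableSet B) {R : ℝ}
    (hBR : B ⊆ Metric.closedBall 0 R) {t : ℝ} (ht : t ∈ Ioc 0 T) :
    ∫ η in B, (𝓕 (u t) : L2 n) η =
      ∫ η in B, mittagLeffler γ (-negLaplacianSymbol η * t ^ γ) • (𝓕 (u 0) : L2 n) η := by
  have hBfin : volume B < ⊤ := (measure_mono hBR).trans_lt measure_closedBall_lt_top
  obtain ⟨ℓ, M, hℓ, hM⟩ := exists_momentCLM hB hBR
  obtain ⟨K, hK⟩ := isCompact_Icc.exists_bound_of_continuousOn hu.continuousOn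
  set A := (2 * Real.pi) ^ 2 * R ^ 2 with hA
  have hA0 : 0 ≤ A := by positivity
  have hle : ∀ η ∈ B, negLaplacianSymbol η ≤ A := fun η hη ↦ by
    have : ‖η‖ ≤ R := by simpa using hBR hη
    rw [negLaplacianSymbol, hA]
    gcongr
  have hderiv (k : ℕ) : ∀ s ∈ Ioo 0 T, HasDerivAt (fun t ↦ ℓ k (u t)) (ℓ k (deriv u s)) s :=
    fun s hs ↦ (ℓ k).hasFDerivAt.comp_hasDerivAt s (hu.differentiableAt s hs).hasDerivAt
  have hderiv' (k : ℕ) : ∀ s ∈ Ioo 0 T, deriv (fun t ↦ ℓ k (u t)) s = ℓ k (deriv u s) :=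
    fun s hs ↦ (hderiv k s hs).deriv
  have hcont (k : ℕ) : ContinuousOn (fun t ↦ ℓ k (u t)) (Icc 0 T) :=
    (ℓ k).continuous.comp_continuousOn hu.continuousOn
  -- The functional commutes with the Caputo derivative, and the equation turns the `k`-th moment of
  -- that derivative into minus the moment `k + 1`; applying `I^γ` inverts the Caputo derivative.
  have hV (k : ℕ) : ∀ r ∈ Ioo 0 T, ℓ k (u r) = ℓ k (u 0) - fracInt γ (fun s ↦ ℓ (k + 1) (u s)) r := by
    intro r hr
    have hEq : ∀ s ∈ Ioo 0 T, fracInt (1 - γ) (deriv fun t ↦ ℓ k (u t)) s = -ℓ (k + 1) (u s) := by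
      intro s hs
      have h1 : fracInt (1 - γ) (deriv fun t ↦ ℓ k (u t)) s = ℓ k (caputo γ u s) := by
        unfold fracInt caputo
        rw [map_smul, ← ContinuousLinearMap.intervalIntegral_comp_comm _ (hu.integrable s hs)]
        congr 1
        refine intervalIntegral.integral_congr_Ioo_of_le hs.1.le fun q hq ↦ ?_
        rw [hderiv' k q ⟨hq.1, hq.2.trans hs.2⟩, map_smul, show 1 - γ - 1 = -γ by ring]
      rw [h1, hℓ, hℓ, ← integral_neg]
      refine setIntegral_congr_ae hB ?_
      filter_upwards [fourier_eq_of_eq_laplacian (hu.equation s hs)] with η hη _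
      rw [hη, pow_succ, smul_neg, smul_smul]
    have h2 := sub_eq_fracInt_caputo hγ hγ1 (hcont k)
      (fun s hs ↦ (hderiv k s hs).differentiableAt) (fun s hs ↦ ?_) hr
    · have h3 : fracInt γ (fracInt (1 - γ) (deriv fun t ↦ ℓ k (u t))) r =
          - fracInt γ (fun s ↦ ℓ (k + 1) (u s)) r := by
        unfold fracInt
        rw [← smul_neg, ← intervalIntegral.integral_neg]
        congr 1
        refine intervalIntegral.integral_congr_Ioo_of_le hr.1.le fun q hq ↦ ?_
        have := hEq q ⟨hq.1, hq.2.trans hr.2⟩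
        unfold fracInt at this
        simp only
        rw [this, smul_neg]
      rw [h3] at h2
      linear_combination h2
    · have h4 : IntervalIntegrable (fun q ↦ ℓ k ((s - q) ^ (-γ) • deriv u q)) volume 0 s :=
        ⟨(ℓ k).integrable_comp (hu.integrable s hs).1, (ℓ k).integrable_comp (hu.integrable s hs).2⟩
      refine h4.congr_ae ?_
      rw [uIoc_of_le hs.1.le]
      filter_upwards [self_mem_ae_restrict measurableSet_Ioc] with q hq
      rw [hderiv' k q ⟨hq.1, hq.2.trans_lt hs.2⟩, map_smul]
  have hT : 0 < T := ht.1.trans_le ht.2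
  have hK0 : 0 ≤ K := (norm_nonneg _).trans (hK 0 ⟨le_rfl, hT.le⟩)
  have hsum := hasSum_of_volterra (M := M * K) (R := A) hγ hcont (fun k s hs ↦ by
    refine ((ℓ k).le_opNorm _).trans ?_
    calc ‖ℓ k‖ * ‖u s‖ ≤ (M * A ^ k) * K :=
          mul_le_mul (hM k) (hK s hs) (norm_nonneg _) ((norm_nonneg _).trans (hM k))
      _ = _ := by ring) hV ht
  simp only [hℓ, pow_zero, one_smul] at hsum
  have ht0 := ht.1
  set w : V n → ℂ := ((𝓕 (u 0) : L2 n) : V n → ℂ) with hw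
  have hwi : IntegrableOn w B := integrableOn_fourier _ hBfin.ne
  have hG (j : ℕ) := Real.Gamma_pos_of_pos (by positivity : 0 < γ * j + 1)
  set F : ℕ → V n → ℂ := fun j η ↦
    ((-negLaplacianSymbol η * t ^ γ) ^ j / Real.Gamma (γ * j + 1)) • w η with hF
  have hFF (j : ℕ) (η : V n) : F j η = (t ^ (γ * j) / Real.Gamma (γ * j + 1)) • (-1 : ℝ) ^ j •
      negLaplacianSymbol η ^ j • w η := by
    simp only [hF, smul_smul]
    rw [Real.rpow_mul_natCast ht0.le, mul_pow, neg_pow (negLaplacianSymbol η)]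
    ring_nf
  have hbd (j : ℕ) : ∀ η ∈ B, ‖(-negLaplacianSymbol η * t ^ γ) ^ j / Real.Gamma (γ * j + 1)‖ ≤
      (A * t ^ γ) ^ j / Real.Gamma (γ * j + 1) := by
    intro η hη
    have := hG j
    rw [norm_div, norm_pow, norm_mul, norm_neg, Real.norm_of_nonneg this.le,
      Real.norm_of_nonneg (negLaplacianSymbol_nonneg η), Real.norm_of_nonneg (by positivity)]
    have := hle η hη
    have := negLaplacianSymbol_nonneg η
    gcongr
  have hFi (j : ℕ) : Integrable (F j) (volume.restrict B) := by
    refine Integrable.mono' (hwi.norm.const_mul ((A * t ^ γ) ^ j / Real.Gamma (γ * j + 1))) ?_ ?_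
    · have hcont : Continuous fun η : V n ↦
          (-negLaplacianSymbol η * t ^ γ) ^ j / Real.Gamma (γ * j + 1) :=
        ((continuous_negLaplacianSymbol.neg.mul continuous_const).pow j).div_const _
      exact hcont.aestronglyMeasurable.smul hwi.1
    · filter_upwards [self_mem_ae_restrict hB] with η hη
      rw [norm_smul]
      exact mul_le_mul_of_nonneg_right (hbd j η hη) (norm_nonneg _)
  have hFs : Summable fun j ↦ ∫ η in B, ‖F j η‖ := by
    refine Summable.of_nonneg_of_le (fun j ↦ integral_nonneg fun _ ↦ norm_nonneg _) (fun j ↦ ?_)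
      ((summable_pow_div_Gamma hγ one_pos (A * t ^ γ)).mul_right (∫ η in B, ‖w η‖))
    rw [← integral_const_mul]
    refine setIntegral_mono_on (hFi j).norm (hwi.norm.const_mul _) hB fun η hη ↦ ?_
    rw [norm_smul]
    exact mul_le_mul_of_nonneg_right (hbd j η hη) (norm_nonneg _)
  -- Summing under the integral over `B` gives the Mittag-Leffler side the same terms as `hsum`, and
  -- sums are unique.
  have hmain := hasSum_integral_of_summable_integral_norm hFi hFs
  have h1 : ∫ η in B, ∑' j, F j η =
      ∫ η in B, mittagLeffler γ (-negLaplacianSymbol η * t ^ γ) • w η := by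
    refine integral_congr_ae (Eventually.of_forall fun η ↦ ?_)
    exact ((summable_pow_div_Gamma hγ one_pos _).hasSum.smul_const (w η)).tsum_eq
  rw [h1] at hmain
  refine hsum.unique (hmain.congr_fun fun j ↦ ?_)
  simp only [hFF, integral_smul]

theorem fourier_solution {γ T : ℝ} (hγ : 0 < γ) (hγ1 : γ < 1) {u : ℝ → L2 n}
    {g : L2 n} (hu : IsSolution γ T u g) {t : ℝ} (ht : t ∈ Ioc 0 T) :
    (𝓕 (u t) : L2 n) =ᵐ[volume]
      fun η ↦ mittagLeffler γ (-negLaplacianSymbol η * t ^ γ) • (𝓕 (u 0) : L2 n) η := by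
  have hball (N : ℕ) : ∀ᵐ η ∂(volume.restrict (Metric.closedBall (0 : V n) N)),
      (𝓕 (u t) : L2 n) η =
        mittagLeffler γ (-negLaplacianSymbol η * t ^ γ) • (𝓕 (u 0) : L2 n) η := by
    have hfin : volume (Metric.closedBall (0 : V n) N) < ⊤ := measure_closedBall_lt_top
    refine Integrable.ae_eq_of_forall_setIntegral_eq _ _ (integrableOn_fourier _ hfin.ne) ?_ ?_
    · refine (integrableOn_fourier (u 0) hfin.ne).continuousOn_smul (Continuous.continuousOn ?_)
        (isCompact_closedBall _ _)
      exact (continuous_mittagLeffler hγ).comp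
        (continuous_negLaplacianSymbol.neg.mul continuous_const)
    · intro S hS _
      rw [Measure.restrict_restrict hS]
      exact setIntegral_fourier_solution hγ hγ1 hu (hS.inter measurableSet_closedBall)
        inter_subset_right ht
  have h := (ae_restrict_iUnion_iff (μ := volume) (fun N : ℕ ↦ Metric.closedBall (0 : V n) N)
    (fun η ↦ (𝓕 (u t) : L2 n) η =
        mittagLeffler γ (-negLaplacianSymbol η * t ^ γ) • (𝓕 (u 0) : L2 n) η)).2 hball
  rwa [Metric.iUnion_closedBall_nat, Measure.restrict_univ] at h

theorem hat_solution {γ T : ℝ} (hγ : 0 < γ) (hγ1 : γ < 1) {u : ℝ → L2 n}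
    {g : L2 n} (hu : IsSolution γ T u g) {t : ℝ} (ht : t ∈ Ioc 0 T) :
    hat (u t) =ᵐ[volume] fun ξ ↦ (mittagLeffler γ (-(‖ξ‖ ^ 2) * t ^ γ) : ℂ) * hat (u 0) ξ := by
  have hpi : (2 * Real.pi)⁻¹ ≠ 0 := by positivity
  filter_upwards [ae_comp_smul hpi (fourier_solution hγ hγ1 hu ht)] with ξ hξ
  have h1 : negLaplacianSymbol ((2 * Real.pi)⁻¹ • ξ) = ‖ξ‖ ^ 2 := by
    rw [negLaplacianSymbol, norm_smul, Real.norm_of_nonneg (by positivity)]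
    field_simp
  unfold hat
  rw [hξ, h1, Complex.real_smul]
  ring

/-! ### Linearity, Plancherel and the final value. -/

theorem hat_sub (f g : L2 n) : hat (f - g) =ᵐ[volume] fun ξ ↦ hat f ξ - hat g ξ := by
  have hpi : (2 * Real.pi)⁻¹ ≠ 0 := by positivity
  have h : (𝓕 (f - g) : L2 n) = 𝓕 f - 𝓕 g := (Lp.fourierTransformₗᵢ (V n) ℂ).map_sub f g
  have h2 : (𝓕 (f - g) : L2 n) =ᵐ[volume] fun η ↦ (𝓕 f : L2 n) η - (𝓕 g : L2 n) η := by
    rw [h]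
    exact Lp.coeFn_sub _ _
  filter_upwards [ae_comp_smul hpi h2] with ξ hξ
  unfold hat
  rw [hξ, mul_sub]

theorem aestronglyMeasurable_hat (f : L2 n) : AEStronglyMeasurable (hat f) volume := by
  have hpi : (2 * Real.pi)⁻¹ ≠ 0 := by positivity
  have hq : Measure.QuasiMeasurePreserving (fun ξ : V n ↦ (2 * Real.pi)⁻¹ • ξ) volume volume := by
    refine ⟨measurable_const_smul _, ?_⟩
    rw [Measure.map_addHaar_smul volume hpi]
    exact Measure.smul_absolutelyContinuous
  exact ((Lp.aestronglyMeasurable _).comp_quasiMeasurePreserving hq).const_mul _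

/-- Plancherel: the dilation by `(2π)⁻¹` contributes `(2π)^{n/2}`, which cancels the normalisation
of `hat`. -/
theorem eLpNorm_hat (f : L2 n) : eLpNorm (hat f) 2 volume = ENNReal.ofReal ‖f‖ := by
  have hpi : (2 * Real.pi)⁻¹ ≠ 0 := by positivity
  have h1 : eLpNorm (fun ξ : V n ↦ (𝓕 f : L2 n) ((2 * Real.pi)⁻¹ • ξ)) 2 volume =
      ENNReal.ofReal ((2 * Real.pi) ^ ((n : ℝ) / 2)) * ENNReal.ofReal ‖f‖ := by
    have h2 := eLpNorm_map_measure (p := 2) (μ := volume) (g := (𝓕 f : L2 n))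
      (f := fun ξ : V n ↦ (2 * Real.pi)⁻¹ • ξ) (by
        rw [Measure.map_addHaar_smul volume hpi]
        exact (Lp.aestronglyMeasurable _).smul_measure _) (measurable_const_smul _).aemeasurable
    rw [Measure.map_addHaar_smul volume hpi, eLpNorm_smul_measure_of_ne_top (by norm_num)] at h2
    change _ = eLpNorm (fun ξ : V n ↦ (𝓕 f : L2 n) ((2 * Real.pi)⁻¹ • ξ)) 2 volume at h2
    rw [← h2, ← Lp.enorm_def, ← ofReal_norm, Lp.norm_fourier_eq, smul_eq_mul,
      ENNReal.ofReal_rpow_of_pos (by positivity)]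
    congr 2
    rw [abs_of_pos (by positivity), finrank_euclideanSpace_fin, inv_pow, inv_inv,
      ← Real.rpow_natCast, ← Real.rpow_mul (by positivity)]
    norm_num
    ring_nf
  unfold hat
  have h3 := eLpNorm_const_smul ((((2 * Real.pi) ^ (-(n : ℝ) / 2) : ℝ) : ℂ))
    (fun ξ : V n ↦ (𝓕 f : L2 n) ((2 * Real.pi)⁻¹ • ξ)) 2 volume
  have h4 : ((((2 * Real.pi) ^ (-(n : ℝ) / 2) : ℝ) : ℂ)) •
      (fun ξ : V n ↦ (𝓕 f : L2 n) ((2 * Real.pi)⁻¹ • ξ)) = fun ξ : V n ↦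
      ((((2 * Real.pi) ^ (-(n : ℝ) / 2) : ℝ) : ℂ)) * (𝓕 f : L2 n) ((2 * Real.pi)⁻¹ • ξ) := rfl
  rw [h4] at h3
  rw [h3, h1, ← mul_assoc, ← ofReal_norm, Complex.norm_real,
    Real.norm_of_nonneg (by positivity), ← ENNReal.ofReal_mul (by positivity),
    ← Real.rpow_add (by positivity)]
  simp [neg_div]

theorem ofReal_norm_le_sobolevNorm {l : ℝ} (hl : 0 ≤ l) (f : L2 n) :
    ENNReal.ofReal ‖f‖ ≤ sobolevNorm l f := by
  rw [← eLpNorm_hat]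
  refine eLpNorm_mono fun ξ ↦ ?_
  rw [norm_mul, Complex.norm_real, Real.norm_of_nonneg (by positivity)]
  refine le_mul_of_one_le_left (norm_nonneg _) (Real.one_le_rpow ?_ (by positivity))
  nlinarith [sq_nonneg ‖ξ‖]

theorem IsSolution.eq_final {γ T : ℝ} (hT : 0 < T) {u : ℝ → L2 n} {g : L2 n}
    (hu : IsSolution γ T u g) : u T = g := by
  have h1 : Tendsto u (𝓝[Ioo 0 T] T) (𝓝 (u T)) :=
    ((hu.continuousOn T ⟨hT.le, le_rfl⟩).mono Ioo_subset_Icc_self)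
  rw [nhdsWithin_Ioo_eq_nhdsLT hT] at h1
  have h2 : Tendsto (fun t ↦ ENNReal.ofReal ‖u t - g‖) (𝓝[<] T) (𝓝 0) :=
    tendsto_of_tendsto_of_tendsto_of_le_of_le tendsto_const_nhds hu.final (fun _ ↦ zero_le)
      fun t ↦ ofReal_norm_le_sobolevNorm (by norm_num) _
  have h3 : Tendsto u (𝓝[<] T) (𝓝 g) := by
    rw [tendsto_iff_norm_sub_tendsto_zero]
    have := (ENNReal.tendsto_toReal ENNReal.zero_ne_top).comp h2
    simpa [Function.comp_def] using this
  exact tendsto_nhds_unique h1 h3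

end Fourier

/-! ### Elementary bounds -/

theorem mittagLeffler_neg_pos {γ x : ℝ} (hγ : 0 < γ) (hγ1 : γ < 1) (hx : 0 ≤ x) :
    0 < mittagLeffler γ (-x) := by
  have hG : 0 < Real.Gamma (1 - γ) := Real.Gamma_pos_of_pos (by linarith)
  exact (by positivity : 0 < (1 + Real.Gamma (1 - γ) * x)⁻¹).trans_le
    (mittagLeffler_neg_bounds hγ hγ1 hx).1

/-- Since `t^γ ≤ T^γ`, the upper bound for `E_{γ,1}` loses only a factor `t^{-γ}` against `1 / (1 +
x²)`. At the fixed time `T` the lower bound is itself a multiple of `1 / (1 + x²)`, so the ratio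
loses no decay. -/
theorem exists_mittagLeffler_le {γ T : ℝ} (hγ : 0 < γ) (hγ1 : γ < 1) (hT : 0 < T) :
    ∃ C : ℝ, 0 < C ∧ ∀ t ∈ Ioc 0 T, ∀ x : ℝ,
      mittagLeffler γ (-(x ^ 2) * t ^ γ) ≤ C / t ^ γ / (1 + x ^ 2) ∧
      mittagLeffler γ (-(x ^ 2) * t ^ γ) / mittagLeffler γ (-(x ^ 2) * T ^ γ) ≤ C / t ^ γ := by
  have hG : 0 < Real.Gamma (1 - γ) := Real.Gamma_pos_of_pos (by linarith)
  have hG' : 0 < Real.Gamma (γ + 1) := Real.Gamma_pos_of_pos (by linarith)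
  set G := Real.Gamma (1 - γ)
  set G' := Real.Gamma (γ + 1)
  have hTγ : 0 < T ^ γ := by positivity
  have h1 : ∀ t ∈ Ioc 0 T, ∀ x : ℝ,
      mittagLeffler γ (-(x ^ 2) * t ^ γ) ≤ (T ^ γ + G') / t ^ γ / (1 + x ^ 2) := by
    intro t ht x
    have ht0 := ht.1
    have htγ : 0 < t ^ γ := by positivity
    have htT : t ^ γ ≤ T ^ γ := Real.rpow_le_rpow ht0.le ht.2 hγ.le
    rw [neg_mul]
    refine (mittagLeffler_neg_bounds hγ hγ1 (by positivity)).2.trans ?_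
    change (1 + x ^ 2 * t ^ γ / G')⁻¹ ≤ _
    rw [inv_le_comm₀ (by positivity) (by positivity), inv_div, div_div_eq_mul_div, div_le_iff₀ (by positivity)]
    have h2 : (1 + x ^ 2 * t ^ γ / G') * (T ^ γ + G') =
        T ^ γ + G' + x ^ 2 * t ^ γ * T ^ γ / G' + x ^ 2 * t ^ γ := by field_simp; ring
    rw [h2]
    have : 0 ≤ x ^ 2 * t ^ γ * T ^ γ / G' := by positivity
    nlinarith
  refine ⟨(T ^ γ + G') * (1 + G * T ^ γ), by positivity, fun t ht x ↦ ⟨(h1 t ht x).trans ?_, ?_⟩⟩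
  · have ht0 := ht.1
    gcongr
    exact le_mul_of_one_le_right (by positivity) (by nlinarith [mul_pos hG hTγ])
  · have ht0 := ht.1
    have h3 := (mittagLeffler_neg_bounds hγ hγ1 (by positivity : 0 ≤ x ^ 2 * T ^ γ)).1
    have h4 := mittagLeffler_neg_pos hγ hγ1 (by positivity : 0 ≤ x ^ 2 * T ^ γ)
    rw [← neg_mul] at h3 h4
    rw [div_le_iff₀ h4]
    refine (h1 t ht x).trans ?_
    have h5 : (1 + x ^ 2)⁻¹ ≤ (1 + G * T ^ γ) * (1 + G * (x ^ 2 * T ^ γ))⁻¹ := by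
      rw [← div_eq_mul_inv, inv_le_comm₀ (by positivity) (by positivity), inv_div,
        div_le_iff₀ (by positivity)]
      nlinarith [mul_pos hG hTγ, sq_nonneg x]
    calc (T ^ γ + G') / t ^ γ / (1 + x ^ 2) = (T ^ γ + G') / t ^ γ * (1 + x ^ 2)⁻¹ := rfl
      _ ≤ (T ^ γ + G') / t ^ γ * ((1 + G * T ^ γ) * (1 + G * (x ^ 2 * T ^ γ))⁻¹) := by gcongr
      _ = (T ^ γ + G') * (1 + G * T ^ γ) / t ^ γ * (1 + G * (x ^ 2 * T ^ γ))⁻¹ := by ring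
      _ ≤ _ := by gcongr

/-- For `αx ≤ 1` use `1 - e^{-z} ≤ z` and lower the exponent from `s` to `q`, which needs `q ≤ s`;
for `αx ≥ 1` the left side is below `1 ≤ (αx)^q`. -/
theorem one_sub_exp_le {τ s q α x : ℝ} (hτ : 0 < τ) (hq : 0 ≤ q) (hqs : q ≤ s)
    (hα : 0 ≤ α) (hx : 0 ≤ x) :
    1 - Real.exp (-τ * (α * x) ^ s) ≤ (1 + τ) * α ^ q * (1 + x ^ 2) ^ (q / 2) := by
  have hy : 0 ≤ α * x := by positivity
  have h1 : 1 - Real.exp (-τ * (α * x) ^ s) ≤ (1 + τ) * (α * x) ^ q := by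
    rcases le_total (α * x) 1 with h | h
    · have h2 := Real.rpow_le_rpow_of_exponent_ge' hy h hq hqs
      have h3 := Real.add_one_le_exp (-τ * (α * x) ^ s)
      have h4 : 0 ≤ (α * x) ^ q := by positivity
      nlinarith
    · have h2 := Real.one_le_rpow h hq
      have h3 := Real.exp_pos (-τ * (α * x) ^ s)
      nlinarith
  refine h1.trans ?_
  rw [Real.mul_rpow hα hx, ← mul_assoc]
  gcongr
  calc x ^ q = (x ^ 2) ^ (q / 2) := by
        rw [← Real.rpow_natCast, ← Real.rpow_mul hx]; congr 1; push_cast; ring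
    _ ≤ _ := by gcongr; linarith

theorem rpow_mul_exp_neg_le {a τ z : ℝ} (ha : 0 < a) (hτ : 0 < τ) (hz : 0 ≤ z) :
    z ^ a * Real.exp (-τ * z) ≤ (a / τ) ^ a := by
  have h1 : τ * z / a ≤ Real.exp (τ * z / a) := by linarith [Real.add_one_le_exp (τ * z / a)]
  have h2 := Real.rpow_le_rpow (by positivity) h1 ha.le
  rw [← Real.exp_mul, div_mul_cancel₀ _ ha.ne'] at h2
  calc z ^ a * Real.exp (-τ * z) = (a / τ * (τ * z / a)) ^ a * Real.exp (-τ * z) := by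
        congr 2; field_simp
    _ = (a / τ) ^ a * ((τ * z / a) ^ a * Real.exp (-τ * z)) := by
        rw [Real.mul_rpow (by positivity) (by positivity), mul_assoc]
    _ ≤ (a / τ) ^ a * (Real.exp (τ * z) * Real.exp (-τ * z)) := by gcongr
    _ = _ := by rw [← Real.exp_add]; simp

theorem exists_rpow_mul_exp_le {τ s r X : ℝ} (hτ : 0 < τ) (hs : 0 < s) (hr : 0 < r) (hX : 1 ≤ X) :
    ∃ C : ℝ, 0 < C ∧ ∀ α ∈ Icc 0 X, ∀ x : ℝ, 0 ≤ x → ∀ l ∈ Icc 0 r,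
      α ^ l * ((1 + x ^ 2) ^ (l / 2) * Real.exp (-τ * (α * x) ^ s)) ≤ C := by
  refine ⟨(X ^ 2 + 1) ^ (r / 2) * (1 + (r / s / τ) ^ (r / s)), by positivity, ?_⟩
  intro α hα x hx l hl
  have hα0 := hα.1
  have hy : 0 ≤ α * x := mul_nonneg hα0 hx
  have h1 : α ^ l * (1 + x ^ 2) ^ (l / 2) ≤ (X ^ 2 + (α * x) ^ 2) ^ (r / 2) := by
    calc α ^ l * (1 + x ^ 2) ^ (l / 2) = (α ^ 2 * (1 + x ^ 2)) ^ (l / 2) := by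
          rw [Real.mul_rpow (by positivity) (by positivity),
            ← Real.rpow_natCast α 2, ← Real.rpow_mul hα0]
          congr 2; push_cast; ring
      _ ≤ (X ^ 2 + (α * x) ^ 2) ^ (l / 2) := by
          have : α ^ 2 ≤ X ^ 2 := pow_le_pow_left₀ hα0 hα.2 2
          refine Real.rpow_le_rpow (by positivity) (by nlinarith) (by linarith [hl.1])
      -- As `X ≥ 1` the base is at least one, so `l` may be raised to `r`; this makes the constant
      -- independent of `l`.
      _ ≤ _ := Real.rpow_le_rpow_of_exponent_le (by nlinarith [sq_nonneg (α * x)])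
          (by linarith [hl.2])
  rw [← mul_assoc]
  set y := α * x
  have hE : Real.exp (-τ * y ^ s) ≤ 1 := by
    rw [Real.exp_le_one_iff, neg_mul]
    have : 0 ≤ τ * y ^ s := by positivity
    linarith
  refine (mul_le_mul_of_nonneg_right h1 (Real.exp_pos _).le).trans ?_
  rcases le_total y 1 with h | h
  · calc (X ^ 2 + y ^ 2) ^ (r / 2) * Real.exp (-τ * y ^ s)
        ≤ (X ^ 2 + 1) ^ (r / 2) * 1 := by
          gcongr
          nlinarith
      _ ≤ _ := by
          gcongr
          have : 0 ≤ (r / s / τ) ^ (r / s) := by positivity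
          linarith
  · have h2 : (X ^ 2 + y ^ 2) ^ (r / 2) ≤ (X ^ 2 + 1) ^ (r / 2) * (y ^ s) ^ (r / s) := by
      calc (X ^ 2 + y ^ 2) ^ (r / 2) ≤ ((X ^ 2 + 1) * y ^ 2) ^ (r / 2) := by
            gcongr
            nlinarith [sq_nonneg X, one_le_pow₀ (n := 2) h]
        _ = _ := by
            rw [Real.mul_rpow (by positivity) (by positivity), ← Real.rpow_natCast y 2,
              ← Real.rpow_mul hy, ← Real.rpow_mul hy]
            congr 2
            push_cast
            field_simp
    have h3 := rpow_mul_exp_neg_le (div_pos hr hs) hτ (by positivity : 0 ≤ y ^ s)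
    calc (X ^ 2 + y ^ 2) ^ (r / 2) * Real.exp (-τ * y ^ s)
        ≤ (X ^ 2 + 1) ^ (r / 2) * (y ^ s) ^ (r / s) * Real.exp (-τ * y ^ s) := by gcongr
      _ = (X ^ 2 + 1) ^ (r / 2) * ((y ^ s) ^ (r / s) * Real.exp (-τ * y ^ s)) := by ring
      _ ≤ _ := by
          gcongr
          linarith

/-- The bound `h ≤ 1/2` keeps `y ≥ b/2` and `x ≤ 3a/2`, whence the factor `3`; the numerator of the
difference is at most `2hab`, and dividing by `y` doubles the constant. -/
theorem approx_ratio_bounds {a b x y h : ℝ} (ha : 0 < a) (hb : 0 < b) (hh : h ≤ 1 / 2)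
    (hx : |x - a| ≤ h * a) (hy : |y - b| ≤ h * b) :
    |x / y| ≤ 3 * (a / b) ∧ |a - x / y * b| ≤ 4 * h * a := by
  rw [abs_le] at hx hy
  have hy0 : b / 2 ≤ y := by nlinarith
  have hx0 : 0 ≤ x := by nlinarith
  have hypos : 0 < y := by linarith
  constructor
  · rw [abs_of_nonneg (by positivity), div_le_iff₀ hypos]
    calc x ≤ 3 * (a / b) * (b / 2) := by field_simp; nlinarith
      _ ≤ _ := by gcongr
  · have h1 : a - x / y * b = (a * (y - b) - (x - a) * b) / y := by field_simp; ring
    have hh0 : 0 ≤ h := by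
      have : 0 ≤ h * a := by linarith
      exact nonneg_of_mul_nonneg_left this ha
    have h2 : 0 ≤ h * a := by positivity
    have h3 : |a * (y - b) - (x - a) * b| ≤ 2 * h * a * b := by
      rw [abs_le]; constructor <;> nlinarith
    rw [h1, abs_div, abs_of_pos hypos, div_le_iff₀ hypos]
    refine h3.trans ?_
    nlinarith

/-! ### The regularized solution -/

section Regularized

variable {n : ℕ}

theorem IsApproxSymbol.ae_abs_sub_le {γ T h : ℝ} (hγ : 0 < γ) (hγ1 : γ < 1) {ψ : ℝ → ℝ → ℝ}
    (hh : 0 ≤ h) (hψ : IsApproxSymbol n γ T h ψ) {t : ℝ} (ht : t ∈ Ioc 0 T) :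
    ∀ᵐ ξ : V n, |ψ ‖ξ‖ t - mittagLeffler γ (-(‖ξ‖ ^ 2) * t ^ γ)| ≤
      h * mittagLeffler γ (-(‖ξ‖ ^ 2) * t ^ γ) := by
  have h1 := hψ.bound t ht
  rw [eLpNorm_exponent_top] at h1
  filter_upwards [ae_le_eLpNormEssSup (f := fun ξ : V n ↦
    (ψ ‖ξ‖ t - mittagLeffler γ (-(‖ξ‖ ^ 2) * t ^ γ)) / mittagLeffler γ (-(‖ξ‖ ^ 2) * t ^ γ))
    (μ := volume)] with ξ hξ
  have ht0 := ht.1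
  have hpos := mittagLeffler_neg_pos hγ hγ1 (by positivity : 0 ≤ ‖ξ‖ ^ 2 * t ^ γ)
  rw [← neg_mul] at hpos
  have h2 := hξ.trans h1
  rwa [← ofReal_norm, ENNReal.ofReal_le_ofReal_iff hh, Real.norm_eq_abs, abs_div,
    abs_of_pos hpos, div_le_iff₀ hpos] at h2

/-- The Fourier multiplier that defines the regularized solution. -/
noncomputable def regMultiplier (τ s T : ℝ) (ψ : ℝ → ℝ → ℝ) (α t : ℝ) (ξ : V n) : ℝ :=
  Real.exp (-τ * ‖α • ξ‖ ^ s) * (ψ ‖ξ‖ t / ψ ‖ξ‖ T)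

/-- The almost everywhere bound on the multiplier makes the product square-integrable, so `invHat`
does not take its default value `0`. -/
theorem hat_regularized {γ τ s T h α C : ℝ} {ψ : ℝ → ℝ → ℝ}
    (hψ : IsApproxSymbol n γ T h ψ) (gδ : L2 n) {t : ℝ} (ht : t ∈ Ioc 0 T)
    (hC : ∀ᵐ ξ : V n, |regMultiplier τ s T ψ α t ξ| ≤ C) :
    hat (regularized τ s T ψ gδ α t) =ᵐ[volume] fun ξ ↦
      (regMultiplier τ s T ψ α t ξ : ℂ) * hat gδ ξ := by
  have hTmem : T ∈ Ioc 0 T := ⟨ht.1.trans_le ht.2, le_rfl⟩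
  have heq : (fun ξ : V n ↦ (((2 * Real.pi) ^ ((n : ℝ) / 2) * kernelHat n τ s (α • ξ) *
      (ψ ‖ξ‖ t / ψ ‖ξ‖ T) : ℝ) : ℂ) * hat gδ ξ) =
      fun ξ ↦ (regMultiplier τ s T ψ α t ξ : ℂ) * hat gδ ξ := by
    ext ξ
    have : (2 * Real.pi) ^ ((n : ℝ) / 2) * (2 * Real.pi) ^ (-(n : ℝ) / 2) = 1 := by
      rw [← Real.rpow_add (by positivity)]; simp [neg_div]
    rw [kernelHat, ← mul_assoc, this, one_mul, regMultiplier]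
  unfold regularized
  rw [heq]
  refine hat_invHat ?_
  have hmem : MemLp (hat gδ) 2 volume :=
    ⟨aestronglyMeasurable_hat gδ, by rw [eLpNorm_hat]; exact ENNReal.ofReal_lt_top⟩
  refine hmem.of_le_mul (c := C) ?_ ?_
  · refine AEStronglyMeasurable.mul ?_ (aestronglyMeasurable_hat gδ)
    refine Complex.continuous_ofReal.comp_aestronglyMeasurable ?_
    unfold regMultiplier
    refine AEStronglyMeasurable.mul ?_ ((hψ.aestronglyMeasurable t ht).aemeasurable.div
      (hψ.aestronglyMeasurable T hTmem).aemeasurable).aestronglyMeasurable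
    exact (by fun_prop : Measurable fun ξ : V n ↦ Real.exp (-τ * ‖α • ξ‖ ^ s)).aestronglyMeasurable
  · filter_upwards [hC] with ξ hξ
    rw [norm_mul, Complex.norm_real]
    exact mul_le_mul_of_nonneg_right hξ (norm_nonneg _)

end Regularized

/-! ### Parameter choice and the error estimate. -/

/-- All quantities are powers of `X = h + δ/E ≤ 1 + κ`. The second bound splits off `X^{l/(p+2)} ≤ 1
+ κ`; the last uses `δ + hE = XE`. -/
theorem parameter_bounds {p κ E δ h l : ℝ} (hp : 0 < p) (hκ : 0 < κ) (hE : 0 < E) (hδ : 0 ≤ δ)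
    (hδE : δ ≤ κ * E) (hh : 0 ≤ h) (hh2 : h ≤ 1 / 2) (hl : l ∈ Icc 0 (p + 2)) :
    (h + δ / E) ^ (1 / (p + 2)) ∈ Icc 0 (1 + κ) ∧
    h + δ / E ≤ (1 + κ) * ((h + δ / E) ^ (1 / (p + 2))) ^ (p + 2 - l) ∧
    ((h + δ / E) ^ (1 / (p + 2))) ^ l * ((h + δ / E) ^ (1 / (p + 2))) ^ (p + 2 - l) = h + δ / E ∧
    ((h + δ / E) ^ (1 / (p + 2))) ^ (p + 2 - l) * E =
      E ^ (l / (p + 2)) * (δ + h * E) ^ (1 - l / (p + 2)) := by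
  have hp2 : 0 < p + 2 := by linarith
  have hX0 : 0 ≤ h + δ / E := by positivity
  have hX1 : h + δ / E ≤ 1 + κ := by
    have : δ / E ≤ κ := (div_le_iff₀ hE).2 hδE
    linarith
  set X := h + δ / E with hX
  have hα (r : ℝ) : (X ^ (1 / (p + 2))) ^ r = X ^ (r / (p + 2)) := by
    rw [← Real.rpow_mul hX0]; congr 1; ring
  have hone : l / (p + 2) + (p + 2 - l) / (p + 2) = 1 := by field_simp; ring
  have hl0 : 0 ≤ l / (p + 2) := div_nonneg hl.1 hp2.le
  have hl1 : 0 ≤ (p + 2 - l) / (p + 2) := div_nonneg (by linarith [hl.2]) hp2.le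
  have hpow {r : ℝ} (hr0 : 0 ≤ r) (hr : r ≤ 1) : X ^ r ≤ 1 + κ :=
    calc X ^ r ≤ (1 + κ) ^ r := Real.rpow_le_rpow hX0 hX1 hr0
      _ ≤ (1 + κ) ^ (1 : ℝ) := Real.rpow_le_rpow_of_exponent_le (by linarith) hr
      _ = 1 + κ := Real.rpow_one _
  have hprod : X ^ (l / (p + 2)) * X ^ ((p + 2 - l) / (p + 2)) = X := by
    rw [← Real.rpow_add_of_nonneg hX0 hl0 hl1, hone, Real.rpow_one]
  refine ⟨⟨by positivity, hpow (by positivity) ?_⟩, ?_, ?_, ?_⟩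
  · rw [div_le_one hp2]; linarith
  · rw [hα]
    calc X = X ^ (l / (p + 2)) * X ^ ((p + 2 - l) / (p + 2)) := hprod.symm
      _ ≤ _ := by
        gcongr
        exact hpow hl0 (by linarith)
  · rw [hα, hα, hprod]
  · have h1 : δ + h * E = X * E := by rw [hX]; field_simp; ring
    have h2 : (p + 2 - l) / (p + 2) = 1 - l / (p + 2) := by linarith
    rw [hα, h1, h2, Real.mul_rpow hX0 hE.le, mul_left_comm, ← Real.rpow_add hE]
    simp

/-- Pointwise error of the regularized symbol. Here `e`, `r` stand for the exact symbol at time `t`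
and the ratio of approximate symbols, `f` for the initial value and `d` for the data error. -/
theorem pointwise_error_le {w w' e eT r K A₀ A₁ A₂ : ℝ} {f d : ℂ} (hw : 0 ≤ w)
    (hK0 : 0 ≤ K) (hK1 : K ≤ 1)
    (h1 : w * e * (1 - K) ≤ A₀ * w') (h2 : w * |e - r * eT| ≤ A₁ * w')
    (he : 0 ≤ e) (h3 : w * K * |r| * ‖d‖ ≤ A₂ * ‖d‖) :
    w * ‖(e : ℂ) * f - ((K * r : ℝ) : ℂ) * ((eT : ℂ) * f - d)‖ ≤
      (A₀ + A₁) * (w' * ‖f‖) + A₂ * ‖d‖ := by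
  -- Bias of the mollifier, error of the symbol, and propagated noise, in this order.
  have hid : (e : ℂ) * f - ((K * r : ℝ) : ℂ) * ((eT : ℂ) * f - d) =
      ((e * (1 - K) : ℝ) : ℂ) * f + ((K * (e - r * eT) : ℝ) : ℂ) * f + ((K * r : ℝ) : ℂ) * d := by
    push_cast; ring
  have hK : 0 ≤ 1 - K := by linarith
  have htri : ‖(e : ℂ) * f - ((K * r : ℝ) : ℂ) * ((eT : ℂ) * f - d)‖ ≤
      e * (1 - K) * ‖f‖ + K * |e - r * eT| * ‖f‖ + K * |r| * ‖d‖ := by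
    rw [hid]
    refine (norm_add₃_le).trans_eq ?_
    simp only [norm_mul, Complex.norm_real, Real.norm_eq_abs, abs_of_nonneg hK0,
      abs_of_nonneg hK, abs_of_nonneg he]
  have hf := norm_nonneg f
  calc w * ‖(e : ℂ) * f - ((K * r : ℝ) : ℂ) * ((eT : ℂ) * f - d)‖
      ≤ w * (e * (1 - K) * ‖f‖ + K * |e - r * eT| * ‖f‖ + K * |r| * ‖d‖) := by gcongr
    _ = w * e * (1 - K) * ‖f‖ + K * (w * |e - r * eT|) * ‖f‖ + w * K * |r| * ‖d‖ := by ring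
    _ ≤ A₀ * w' * ‖f‖ + 1 * (A₁ * w') * ‖f‖ + A₂ * ‖d‖ := by gcongr
    _ = _ := by ring

end FracDiffusion

theorem mainTheorem5 (n : ℕ) (γ T τ s p κ : ℝ) (hγ : γ ∈ Set.Ioo (0 : ℝ) 1) (hT : 0 < T)
    (hτ : 0 < τ) (hs : 0 < s) (hp : 0 < p) (hκ : 0 < κ) :
    ∃ C : ℝ, 0 < C ∧
      ∀ (u : ℝ → L2 n) (g gδ : L2 n) (ψ : ℝ → ℝ → ℝ) (E δ h : ℝ),
        IsSolution γ T u g →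
        0 < E → sobolevNorm p (u 0) ≤ ENNReal.ofReal E →
        ‖g - gδ‖ ≤ δ → δ ≤ κ * E →
        0 ≤ h → h ≤ 1 / 2 → IsApproxSymbol n γ T h ψ →
        ∀ t ∈ Set.Ioc 0 T, ∀ l ∈ Set.Icc 0 (p + 2), p + 2 - l ≤ s →
          sobolevNorm l
              (u t - regularized τ s T ψ gδ ((h + δ / E) ^ (1 / (p + 2))) t) ≤
            ENNReal.ofReal
              (C / t ^ γ * E ^ (l / (p + 2)) * (δ + h * E) ^ (1 - l / (p + 2))) := by
  obtain ⟨hγ0, hγ1⟩ := hγ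
  obtain ⟨C₁, hC₁, hml⟩ := exists_mittagLeffler_le hγ0 hγ1 hT
  obtain ⟨C₅, hC₅, hexp⟩ := exists_rpow_mul_exp_le (X := 1 + κ) hτ hs (by linarith : 0 < p + 2)
    (by linarith)
  -- The three summands come from the bias, the symbol error (through `h ≤ (1 + κ) α^{p+2-l}`) and
  -- the noise.
  refine ⟨C₁ * (1 + τ) + 4 * C₁ * (1 + κ) + 3 * C₁ * C₅, by positivity, ?_⟩
  intro u g gδ ψ E δ h hu hE hEp hgδ hδE hh hh2 hψ t ht l hl hls
  have hδ : 0 ≤ δ := (norm_nonneg _).trans hgδ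
  obtain ⟨hα, hαh, hαl, hαE⟩ := parameter_bounds hp hκ hE hδ hδE hh hh2 hl
  rw [mul_assoc, ← hαE]
  set α := (h + δ / E) ^ (1 / (p + 2)) with hαdef
  have hTm : T ∈ Ioc 0 T := ⟨hT, le_rfl⟩
  have ht0 := ht.1
  have htγ : 0 < t ^ γ := by positivity
  set q := p + 2 - l with hq
  have hq0 : 0 ≤ q := by linarith [hl.2]
  have hα0 := hα.1
  have hαq : 0 ≤ α ^ q := by positivity
  set e : ℝ → V n → ℝ := fun t ξ ↦ mittagLeffler γ (-(‖ξ‖ ^ 2) * t ^ γ) with he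
  have hepos (t : ℝ) (ht : 0 < t) (ξ : V n) : 0 < e t ξ := by
    have := mittagLeffler_neg_pos hγ0 hγ1 (by positivity : 0 ≤ ‖ξ‖ ^ 2 * t ^ γ)
    rwa [← neg_mul] at this
  have happ : ∀ᵐ ξ : V n, |ψ ‖ξ‖ t / ψ ‖ξ‖ T| ≤ 3 * (e t ξ / e T ξ) ∧
      |e t ξ - ψ ‖ξ‖ t / ψ ‖ξ‖ T * e T ξ| ≤ 4 * h * e t ξ := by
    filter_upwards [hψ.ae_abs_sub_le hγ0 hγ1 hh ht, hψ.ae_abs_sub_le hγ0 hγ1 hh hTm] with ξ h1 h2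
    exact approx_ratio_bounds (hepos t ht0 ξ) (hepos T hT ξ) hh2 h1 h2
  have hK0 (ξ : V n) : 0 ≤ Real.exp (-τ * ‖α • ξ‖ ^ s) := (Real.exp_pos _).le
  have hK1 (ξ : V n) : Real.exp (-τ * ‖α • ξ‖ ^ s) ≤ 1 := by
    rw [Real.exp_le_one_iff, neg_mul]
    have : 0 ≤ τ * ‖α • ξ‖ ^ s := by positivity
    linarith
  have hmult : ∀ᵐ ξ : V n, |regMultiplier τ s T ψ α t ξ| ≤ 3 * (C₁ / t ^ γ) := by
    filter_upwards [happ] with ξ hξ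
    rw [regMultiplier, abs_mul, abs_of_nonneg (hK0 ξ)]
    calc _ ≤ 1 * (3 * (e t ξ / e T ξ)) := by
          gcongr
          exacts [hK1 ξ, hξ.1]
      _ ≤ _ := by
          rw [one_mul]
          exact mul_le_mul_of_nonneg_left (hml t ht ‖ξ‖).2 (by norm_num)
  -- If `α = 0` then `h = δ = 0`: there is no mollification, but the data are exact, so the noise
  -- estimate with `α^{-l}` is needed only for `α > 0`.
  have hdata : ∀ᵐ ξ : V n, 0 < α ∨ hat (g - gδ) ξ = 0 := by
    rcases hα0.eq_or_lt with h0 | h0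
    · have hX0 : 0 ≤ h + δ / E := by positivity
      have hX : h + δ / E ≤ 0 := by
        have hne : 1 / (p + 2) ≠ 0 := by positivity
        exact ((Real.rpow_eq_zero hX0 hne).1 h0.symm).le
      have hδ0 : δ = 0 := by
        have : δ / E ≤ 0 := by linarith
        have := (div_le_iff₀ hE).1 this
        linarith
      have h1 : eLpNorm (hat (g - gδ)) 2 volume = 0 := by
        rw [eLpNorm_hat]
        exact ENNReal.ofReal_eq_zero.2 (hgδ.trans hδ0.le)
      rw [eLpNorm_eq_zero_iff (aestronglyMeasurable_hat _) (by norm_num)] at h1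
      filter_upwards [h1] with ξ hξ using Or.inr hξ
    · exact Eventually.of_forall fun _ ↦ Or.inl h0
  set A₀ := C₁ / t ^ γ * ((1 + τ) * α ^ q) with hA₀
  set A₁ := 4 * h * (C₁ / t ^ γ) with hA₁
  set A₂ := 3 * (C₁ / t ^ γ) * (C₅ * α ^ (-l)) with hA₂
  have hpt : ∀ᵐ ξ : V n, ‖(((1 + ‖ξ‖ ^ 2) ^ (l / 2) : ℝ) : ℂ) *
      hat (u t - regularized τ s T ψ gδ α t) ξ‖ ≤
      (A₀ + A₁) * ‖(((1 + ‖ξ‖ ^ 2) ^ (p / 2) : ℝ) : ℂ) * hat (u 0) ξ‖ +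
        A₂ * ‖hat (g - gδ) ξ‖ := by
    filter_upwards [hat_sub (u t) (regularized τ s T ψ gδ α t), hat_sub g gδ,
      hat_solution hγ0 hγ1 hu ht, hat_solution hγ0 hγ1 hu hTm, hat_regularized hψ gδ ht hmult,
      happ, hdata] with ξ h1 h2 h3 h4 h5 h6 h7
    rw [hu.eq_final hT] at h4
    have hgδ' : hat gδ ξ = (e T ξ : ℂ) * hat (u 0) ξ - hat (g - gδ) ξ := by rw [h2, h4]; ring
    rw [h1, h3, h5, hgδ', regMultiplier, norm_mul, norm_mul, Complex.norm_real, Complex.norm_real,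
      Real.norm_of_nonneg (by positivity), Real.norm_of_nonneg (by positivity)]
    have hW : 0 < 1 + ‖ξ‖ ^ 2 := by positivity
    -- Weight count: `l` from the norm, `-2` from the decay of `e_t` and `q = p + 2 - l` from the
    -- mollifier add up to `p`, the smoothness of the initial value.
    have hwsplit : (1 + ‖ξ‖ ^ 2) ^ (l / 2) / (1 + ‖ξ‖ ^ 2) * (1 + ‖ξ‖ ^ 2) ^ (q / 2) =
        (1 + ‖ξ‖ ^ 2) ^ (p / 2) := by
      rw [← Real.rpow_sub_one hW.ne', ← Real.rpow_add hW]
      congr 1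
      rw [hq]
      ring
    have hWq : 1 ≤ (1 + ‖ξ‖ ^ 2) ^ (q / 2) :=
      Real.one_le_rpow (by nlinarith [sq_nonneg ‖ξ‖]) (by positivity)
    have hwe : (1 + ‖ξ‖ ^ 2) ^ (l / 2) * e t ξ ≤
        C₁ / t ^ γ * ((1 + ‖ξ‖ ^ 2) ^ (l / 2) / (1 + ‖ξ‖ ^ 2)) := by
      calc _ ≤ (1 + ‖ξ‖ ^ 2) ^ (l / 2) * (C₁ / t ^ γ / (1 + ‖ξ‖ ^ 2)) := by
            gcongr
            exact (hml t ht ‖ξ‖).1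
        _ = _ := by ring
    have hnorm : ‖α • ξ‖ = α * ‖ξ‖ := by rw [norm_smul, Real.norm_of_nonneg hα0]
    refine pointwise_error_le (by positivity) (hK0 ξ) (hK1 ξ) ?_ ?_ (hepos t ht0 ξ).le ?_
    · rw [hnorm]
      have hI := one_sub_exp_le hτ hq0 hls hα0 (norm_nonneg ξ)
      have hK' : 0 ≤ 1 - Real.exp (-τ * (α * ‖ξ‖) ^ s) := by
        have := hK1 ξ; rw [hnorm] at this; linarith
      calc (1 + ‖ξ‖ ^ 2) ^ (l / 2) * e t ξ * (1 - Real.exp (-τ * (α * ‖ξ‖) ^ s))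
          ≤ C₁ / t ^ γ * ((1 + ‖ξ‖ ^ 2) ^ (l / 2) / (1 + ‖ξ‖ ^ 2)) *
            ((1 + τ) * α ^ q * (1 + ‖ξ‖ ^ 2) ^ (q / 2)) := by gcongr
        _ = A₀ * ((1 + ‖ξ‖ ^ 2) ^ (l / 2) / (1 + ‖ξ‖ ^ 2) * (1 + ‖ξ‖ ^ 2) ^ (q / 2)) := by
            rw [hA₀]; ring
        _ = _ := by rw [hwsplit]
    · calc (1 + ‖ξ‖ ^ 2) ^ (l / 2) * |e t ξ - ψ ‖ξ‖ t / ψ ‖ξ‖ T * e T ξ|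
          ≤ (1 + ‖ξ‖ ^ 2) ^ (l / 2) * (4 * h * e t ξ) := by
            gcongr
            exact h6.2
        _ = 4 * h * ((1 + ‖ξ‖ ^ 2) ^ (l / 2) * e t ξ) := by ring
        _ ≤ 4 * h * (C₁ / t ^ γ * ((1 + ‖ξ‖ ^ 2) ^ (l / 2) / (1 + ‖ξ‖ ^ 2) *
              (1 + ‖ξ‖ ^ 2) ^ (q / 2))) := by
            refine mul_le_mul_of_nonneg_left (hwe.trans ?_) (by positivity)
            gcongr
            exact le_mul_of_one_le_right (by positivity) hWq
        _ = _ := by rw [hwsplit, hA₁]; ring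
    · rcases h7 with h7 | h7
      · gcongr
        have hX := hexp α hα ‖ξ‖ (norm_nonneg ξ) l hl
        rw [hnorm]
        have h8 : (1 + ‖ξ‖ ^ 2) ^ (l / 2) * Real.exp (-τ * (α * ‖ξ‖) ^ s) ≤ C₅ * α ^ (-l) := by
          rw [Real.rpow_neg hα0, ← div_eq_mul_inv, le_div_iff₀ (by positivity), mul_comm]
          exact hX
        calc (1 + ‖ξ‖ ^ 2) ^ (l / 2) * Real.exp (-τ * (α * ‖ξ‖) ^ s) * |ψ ‖ξ‖ t / ψ ‖ξ‖ T|
            ≤ C₅ * α ^ (-l) * (3 * (C₁ / t ^ γ)) := by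
              gcongr
              exact h6.1.trans (mul_le_mul_of_nonneg_left (hml t ht ‖ξ‖).2 (by norm_num))
          _ = _ := by rw [hA₂]; ring
      · simp [h7]
  have hA₀0 : 0 ≤ A₀ := by positivity
  have hA₁0 : 0 ≤ A₁ := by positivity
  have hA₂0 : 0 ≤ A₂ := by positivity
  have hfm : AEStronglyMeasurable (fun ξ : V n ↦
      (((1 + ‖ξ‖ ^ 2) ^ (p / 2) : ℝ) : ℂ) * hat (u 0) ξ) volume :=
    ((by fun_prop : Measurable fun ξ : V n ↦
      (((1 + ‖ξ‖ ^ 2) ^ (p / 2) : ℝ) : ℂ)).aestronglyMeasurable).mul (aestronglyMeasurable_hat _)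
  have hdm := aestronglyMeasurable_hat (g - gδ)
  have hscale {c : ℝ} (hc : 0 ≤ c) (f : V n → ℂ) :
      eLpNorm (fun ξ ↦ c * ‖f ξ‖) 2 volume = ENNReal.ofReal c * eLpNorm f 2 volume := by
    have := eLpNorm_const_smul c (fun ξ ↦ ‖f ξ‖) 2 (volume : Measure (V n))
    rw [eLpNorm_norm, ← ofReal_norm, Real.norm_of_nonneg hc] at this
    exact this
  -- This balances noise against bias: `δ ≤ (h + δ/E) E = α^l α^q E`, so `α^{-l} δ ≤ α^q E`.
  have hδα : A₂ * δ ≤ 3 * (C₁ / t ^ γ) * (C₅ * (α ^ q * E)) := by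
    have h1 : α ^ (-l) * δ ≤ α ^ q * E := by
      have h2 : δ ≤ α ^ l * α ^ q * E := by
        rw [hαl, add_mul, div_mul_cancel₀ _ hE.ne']
        have : 0 ≤ h * E := by positivity
        linarith
      rcases (Real.rpow_nonneg hα0 l).eq_or_lt with h3 | h3
      · have : δ ≤ 0 := by rw [← h3] at h2; simpa using h2
        have h4 : δ = 0 := le_antisymm this hδ
        rw [h4, mul_zero]
        positivity
      · rw [Real.rpow_neg hα0, inv_mul_le_iff₀ h3]
        linarith
    calc A₂ * δ = 3 * (C₁ / t ^ γ) * (C₅ * (α ^ (-l) * δ)) := by rw [hA₂]; ring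
      _ ≤ _ := by gcongr
  have hhα : h ≤ (1 + κ) * α ^ q := by
    have : 0 ≤ δ / E := by positivity
    linarith
  calc sobolevNorm l (u t - regularized τ s T ψ gδ α t)
      ≤ eLpNorm ((fun ξ : V n ↦ (A₀ + A₁) * ‖(((1 + ‖ξ‖ ^ 2) ^ (p / 2) : ℝ) : ℂ) *
          hat (u 0) ξ‖) + fun ξ ↦ A₂ * ‖hat (g - gδ) ξ‖) 2 volume := eLpNorm_mono_ae_real hpt
    _ ≤ _ := eLpNorm_add_le (hfm.norm.const_mul _) (hdm.norm.const_mul _) (by norm_num)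
    _ = ENNReal.ofReal (A₀ + A₁) * sobolevNorm p (u 0) +
          ENNReal.ofReal A₂ * ENNReal.ofReal ‖g - gδ‖ := by
        rw [hscale (by positivity), hscale hA₂0, eLpNorm_hat]
        rfl
    _ ≤ ENNReal.ofReal (A₀ + A₁) * ENNReal.ofReal E +
          ENNReal.ofReal A₂ * ENNReal.ofReal δ := by gcongr
    _ = ENNReal.ofReal ((A₀ + A₁) * E + A₂ * δ) := by
        rw [← ENNReal.ofReal_mul (by positivity), ← ENNReal.ofReal_mul hA₂0,
          ← ENNReal.ofReal_add (by positivity) (by positivity)]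
    _ ≤ _ := by
        refine ENNReal.ofReal_le_ofReal ?_
        calc (A₀ + A₁) * E + A₂ * δ
            ≤ (C₁ / t ^ γ * ((1 + τ) * α ^ q) + 4 * ((1 + κ) * α ^ q) * (C₁ / t ^ γ)) * E +
              3 * (C₁ / t ^ γ) * (C₅ * (α ^ q * E)) := by
              rw [hA₀, hA₁]
              gcongr
          _ = _ := by ring
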